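/- Let $K$ be an algebraically closed field of characteristic zero, let $d \ge 1$, and let $\lambda = (1^{e_1} 2^{e_2} \cdots d^{e_d})$ be a partition of $d$, where $e_r$ is the number of parts equal to $r$. Identify the point $(a_0 : \cdots : a_d)$ of $\mathbb{P}^d_K$ with the nonzero binary form $\sum_{j=0}^d a_j x^{d-j} y^j$ (up to a nonzero scalar). Let the coincident root locus $X_\lambda \subseteq \mathbb{P}^d_K$ be the reduced closed subscheme whose closed points are the forms $\prod_{r=1}^d G_r^r$ with each $G_r \in K[x,y]$ a nonzero binary form of degree $e_r$ (equivalently, the nonzero forms $\prod_i L_i^{\lambda_i}$ with linear forms $L_i$, where $\lambda_1, \lambda_2, \dots$ are the parts of $\lambda$). Then $X_\lambda$ is smooth over $K$ if and only if $\lambda$ is even, that is, all parts of $\lambda$ are equal. -/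

import Mathlib

open AlgebraicGeometry CategoryTheory

noncomputable section

universe u

namespace CoincidentRoot

/-- A partition is even if all its parts are equal. -/
def IsEven {d : ℕ} (lam : d.Partition) : Prop :=
  ∀ r ∈ lam.parts, ∀ s ∈ lam.parts, r = s

section Forms

variable (K : Type u) [Field K]

/-- The binary form `∑ j, a j * x ^ (d - j) * y ^ j` with coefficient vector `a`, where `x` and `y`
are the variables `X 0` and `X 1`. -/
def binaryForm {d : ℕ} (a : Fin (d + 1) → K) : MvPolynomial (Fin 2) K :=
  ∑ j : Fin (d + 1),
    MvPolynomial.C (a j) * MvPolynomial.X 0 ^ (d - (j : ℕ)) * MvPolynomial.X 1 ^ (j : ℕ)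

/-- Write `lam = (1 ^ e₁ 2 ^ e₂ … d ^ e_d)`. This is the set of homogeneous coordinate vectors of
the points of projective `d`-space in the image of the map
`∏ r, ℙ(Sym ^ (e r)) → ℙ(Sym ^ d)`, `(G₁, …, G_d) ↦ ∏ r, G r ^ r`: the coefficient vectors
of the binary forms that equal, up to a nonzero scalar, such a product with each `G r` a nonzero
binary form of degree `e r`. -/
def coneOver {d : ℕ} (lam : d.Partition) : Set (Fin (d + 1) → K) :=
  {a | ∃ (c : Kˣ) (G : ℕ → MvPolynomial (Fin 2) K),
    (∀ r ∈ Finset.Icc 1 d, G r ≠ 0 ∧ (G r).IsHomogeneous (lam.parts.count r)) ∧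
    binaryForm K a = MvPolynomial.C (c : K) * ∏ r ∈ Finset.Icc 1 d, G r ^ r}

/-- The standard grading of the polynomial ring `K[z₀, …, z_d]`. -/
abbrev grading (d : ℕ) : ℕ → Submodule K (MvPolynomial (Fin (d + 1)) K) :=
  MvPolynomial.homogeneousSubmodule (Fin (d + 1)) K

instance gradedAlgebraGrading (d : ℕ) : GradedAlgebra (grading K d) :=
  MvPolynomial.gradedAlgebra

/-- Projective `d`-space over `K`, with homogeneous coordinates the coefficients of a binary
form. -/
abbrev projSpace (d : ℕ) : Scheme.{u} := Proj (grading K d)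

/-- The structure morphism of projective space. -/
def projSpaceToSpec (d : ℕ) : projSpace K d ⟶ Spec (.of K) :=
  Proj.toSpecZero (grading K d) ≫ Spec.map (CommRingCat.ofHom (algebraMap K (grading K d 0)))

/-- The closed subset of projective space cut out by all the polynomials that vanish on the
homogeneous coordinate vectors of the points of the coincident root locus. -/
def locus {d : ℕ} (lam : d.Partition) : TopologicalSpace.Closeds (projSpace K d) :=
  ⟨ProjectiveSpectrum.zeroLocus (grading K d)
      (MvPolynomial.vanishingIdeal K (coneOver K lam) : Set (MvPolynomial (Fin (d + 1)) K)),
    ProjectiveSpectrum.isClosed_zeroLocus (grading K d) _⟩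

/-- The coincident root locus `X_lam`: the reduced closed subscheme of projective space with
underlying set `locus K lam`. -/
def coincidentRootLocus {d : ℕ} (lam : d.Partition) : Scheme.{u} :=
  (Scheme.IdealSheafData.vanishingIdeal (locus K lam)).subscheme

/-- The structure morphism of the coincident root locus. -/
def coincidentRootLocusToSpec {d : ℕ} (lam : d.Partition) :
    coincidentRootLocus K lam ⟶ Spec (.of K) :=
  (Scheme.IdealSheafData.vanishingIdeal (locus K lam)).subschemeι ≫ projSpaceToSpec K d

end Forms

end CoincidentRoot

end

/-! On the open set of forms F with F(1,t) ≠ 0, scale so that F(1,t) = 1. The locus there is the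
image of an affine space under a polynomial map. Hence the coordinate ring of the reduced chart is
the subalgebra D of a polynomial ring generated by the coefficients of the generic member f of the
family, and the chart is smooth iff D is (`smooth_chart_valueAt_iff`).

If all parts equal m, then f is the m-th power of a generic g with g(t) = 1. As m is invertible, the
coefficients of g^m recover those of g one after another. So D is the whole polynomial ring and
every chart is an affine space (`adjoin_coeff_genericPoly_pow`).

Conversely, take t = 0 and f = ∏ (1 + x_i T)^(w_i) = ∑ a_k T^k with n factors. As D lies in K[x_1,
…, x_n], its transcendence degree is at most n. If D is smooth, elements with independent classes in
the cotangent space at x = 0 are algebraically independent (`algebraicIndependent_of_linear_part`),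
so there are at most n of them. But a_1, …, a_(n+1) have independent classes unless all w_i are
equal (`weights_eq_of_differential_relation`). Indeed, a relation with linear term α a_(k+1), k ≤ n,
may be taken weighted homogeneous. Its partial derivatives yield a polynomial V of degree k with
leading coefficient ±α that vanishes at x_1, …, x_n. So k = n and V = ±α ∏ (T - x_i). The next
coefficient gives (α + β) ∑ w_i x_i = α ∑ x_i for some constant β, so the w_i agree. If n + 1 > d,
there is no a_(n+1) to use, but then all parts are 1. -/

noncomputable section

namespace CoincidentRoot

/-! ### Reduced closed subschemes of Proj on a basic open set -/

section Chart

variable {A : Type u} {S : Type*} [CommRing A] [SetLike S A] [AddSubgroupClass S A]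
  (𝒜 : ℕ → S) [GradedRing 𝒜] {f : A} {m : ℕ} (f_deg : f ∈ 𝒜 m) (hm : 0 < m)

lemma fromSpec_basicOpen_eq :
    (Proj.isAffineOpen_basicOpen 𝒜 f f_deg hm).fromSpec =
      Spec.map (Proj.awayToSection 𝒜 f) ≫ Proj.awayι 𝒜 f f_deg hm := by
  rw [← cancel_epi (Proj.isAffineOpen_basicOpen 𝒜 f f_deg hm).isoSpec.hom]
  rw [IsAffineOpen.isoSpec_hom, IsAffineOpen.toSpecΓ_fromSpec]
  have := Proj.basicOpenIsoSpec_hom 𝒜 f f_deg hm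
  rw [← Category.assoc]
  change _ = Proj.basicOpenToSpec 𝒜 f ≫ _
  rw [← this, Proj.awayι, Iso.hom_inv_id_assoc]

/-- The basic open subset of a projective spectrum, as an affine open. -/
abbrev affineBasicOpen : (Proj 𝒜).affineOpens :=
  ⟨Proj.basicOpen 𝒜 f, Proj.isAffineOpen_basicOpen 𝒜 f f_deg hm⟩

/-- The ideal sheaf is defined through sections over the affine open; the isomorphism
`Proj.awayToSection` moves it to the ring of homogeneous fractions, where it can be computed. -/
lemma mem_vanishingIdeal_affineBasicOpen (Z : TopologicalSpace.Closeds (Proj 𝒜))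
    (x : HomogeneousLocalization.Away 𝒜 f) :
    (Proj.awayToSection 𝒜 f).hom x ∈
        (Scheme.IdealSheafData.vanishingIdeal Z).ideal (affineBasicOpen 𝒜 f_deg hm) ↔
      x ∈ PrimeSpectrum.vanishingIdeal (Proj.awayι 𝒜 f f_deg hm ⁻¹' (Z : Set (Proj 𝒜))) := by
  have hiso : IsIso (Proj.awayToSection 𝒜 f) := by
    rw [← Proj.basicOpenIsoAway_hom 𝒜 f f_deg hm]; infer_instance
  change _ ∈ PrimeSpectrum.vanishingIdeal
    ((Proj.isAffineOpen_basicOpen 𝒜 f f_deg hm).fromSpec ⁻¹' (Z : Set (Proj 𝒜))) ↔ _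
  rw [fromSpec_basicOpen_eq, PrimeSpectrum.mem_vanishingIdeal, PrimeSpectrum.mem_vanishingIdeal]
  constructor
  · intro h y hy
    obtain ⟨z, rfl⟩ := (Spec.map (Proj.awayToSection 𝒜 f)).surjective y
    exact h z (by simpa using! hy)
  · intro h z hz
    exact h (Spec.map (Proj.awayToSection 𝒜 f) z) (by simpa using! hz)

end Chart

section

open HomogeneousLocalization MvPolynomial

/-! ### The coordinate ring of a parametrized chart -/

section EvalAway

variable {K : Type u} [Field K] {d : ℕ} {ℓ : MvPolynomial (Fin (d + 1)) K}
  {B : Type*} [CommRing B] [Algebra K B] {a : Fin (d + 1) → B} (ha : aeval a ℓ = 1)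

/-- Evaluation of the homogeneous fractions with denominator a power of `ℓ` at a point `a` where
`ℓ` takes the value `1`. -/
def evalAway : Away (grading K d) ℓ →+* B :=
  (IsLocalization.Away.lift (S := Localization.Away ℓ) (g := (aeval a : _ →ₐ[K] B).toRingHom) ℓ
    (by simp [ha])).comp (algebraMap (Away (grading K d) ℓ) (Localization.Away ℓ))

lemma evalAway_mk (hℓ : ℓ ∈ grading K d 1) (n : ℕ) (g : MvPolynomial (Fin (d + 1)) K)
    (hg : g ∈ grading K d (n • 1)) :
    evalAway ha (Away.mk (grading K d) hℓ n g hg) = aeval a g := by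
  have : ℓ ^ n ∈ Submonoid.powers ℓ := ⟨n, rfl⟩
  rw [evalAway, RingHom.comp_apply, HomogeneousLocalization.algebraMap_apply, Away.val_mk,
    Localization.mk_eq_mk', IsLocalization.Away.lift, IsLocalization.lift_mk'_spec]
  simp [ha]

/-- The constants, as homogeneous fractions of degree zero. -/
def constAway (ℓ : MvPolynomial (Fin (d + 1)) K) : K →+* Away (grading K d) ℓ :=
  (fromZeroRingHom (grading K d) (Submonoid.powers ℓ)).comp (algebraMap K (grading K d 0))

lemma evalAway_comp_constAway : (evalAway ha).comp (constAway ℓ) = algebraMap K B := by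
  ext c
  have : (fromZeroRingHom (grading K d) (Submonoid.powers ℓ)
      (algebraMap K (grading K d 0) c)).val = 
        algebraMap (MvPolynomial (Fin (d + 1)) K) (Localization.Away ℓ) (C c) := by
    rw [← Localization.mk_one_eq_algebraMap]; rfl
  rw [evalAway, constAway, RingHom.comp_apply, RingHom.comp_apply, RingHom.comp_apply,
    HomogeneousLocalization.algebraMap_apply, this, IsLocalization.Away.lift_eq]
  simp

lemma mem_range_evalAway (hℓ : ℓ ∈ grading K d 1) (b : B) :
    b ∈ (evalAway ha).range ↔ b ∈ Algebra.adjoin K (Set.range a) := by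
  rw [Algebra.adjoin_range_eq_range_aeval]
  constructor
  · rintro ⟨x, rfl⟩
    obtain ⟨n, g, hg, rfl⟩ := Away.mk_surjective _ hℓ x
    exact ⟨g, (evalAway_mk ha hℓ n g hg).symm⟩
  · rintro ⟨g, rfl⟩
    induction g using MvPolynomial.induction_on with
    | C c =>
      refine ⟨constAway ℓ c, ?_⟩
      rw [← RingHom.comp_apply, evalAway_comp_constAway]
      simp
    | add p q hp hq => simpa using add_mem hp hq
    | mul_X p j hp =>
      rw [map_mul]
      refine mul_mem hp ⟨Away.mk (grading K d) hℓ 1 (X j) ?_, ?_⟩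
      · simpa using isHomogeneous_X K j
      · rw [evalAway_mk]; rfl

end EvalAway

section Locus

variable {K : Type u} [Field K] {d : ℕ}

lemma smul_mem_coneOver {lam : d.Partition} {a : Fin (d + 1) → K} (ha : a ∈ coneOver K lam)
    {s : K} (hs : s ≠ 0) : s • a ∈ coneOver K lam := by
  obtain ⟨c, G, hG, h⟩ := ha
  refine ⟨Units.mk0 s hs * c, G, hG, ?_⟩
  have : binaryForm K (s • a) = C s * binaryForm K a := by
    simp [binaryForm, Finset.mul_sum, mul_assoc]
  rw [this, h]
  simp [mul_assoc]

lemma aeval_smul_of_isHomogeneous {ι R S : Type*} [CommSemiring R] [CommSemiring S] [Algebra R S]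
    {g : MvPolynomial ι R} {n : ℕ} (hg : g.IsHomogeneous n) (s : S) (x : ι → S) :
    aeval (s • x) g = s ^ n * aeval x g := by
  rw [aeval_def, aeval_def, eval₂_eq, eval₂_eq, Finset.mul_sum]
  refine Finset.sum_congr rfl fun m hm => ?_
  have hdeg : ∑ i ∈ m.support, m i = n := by
    rw [← Finsupp.degree_apply, ← hg (mem_support_iff.mp hm), Finsupp.degree_eq_weight_one]
    rfl
  simp only [Pi.smul_apply, smul_eq_mul, mul_pow, Finset.prod_mul_distrib, Finset.prod_pow_eq_pow_sum,
    hdeg]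
  ring

/-- For fixed x in V, g(s • x) is a polynomial in s whose coefficients are the values at x of the
components of g. It vanishes for all s ≠ 0, hence identically. -/
lemma homogeneousComponent_mem_vanishingIdeal {ι : Type*} [Infinite K] {V : Set (ι → K)}
    (hV : ∀ x ∈ V, ∀ s : K, s ≠ 0 → s • x ∈ V) {g : MvPolynomial ι K}
    (hg : g ∈ vanishingIdeal K V) (i : ℕ) : homogeneousComponent i g ∈ vanishingIdeal K V := by
  rw [mem_vanishingIdeal_iff] at hg ⊢
  intro x hx
  let P : Polynomial K := ∑ i ∈ Finset.range (g.totalDegree + 1),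
    Polynomial.C (aeval x (homogeneousComponent i g)) * Polynomial.X ^ i
  have hP : P = 0 := by
    refine Polynomial.eq_zero_of_infinite_isRoot _ (Set.Infinite.mono (s := {0}ᶜ) ?_
      (Set.finite_singleton _).infinite_compl)
    intro s hs
    have := hg _ (hV x hx s hs)
    rw [← sum_homogeneousComponent g, map_sum] at this
    rw [Set.mem_ofPred, Polynomial.IsRoot, Polynomial.eval_finsetSum, ← this]
    refine Finset.sum_congr rfl fun j _ => ?_
    rw [aeval_smul_of_isHomogeneous (homogeneousComponent_isHomogeneous j g)]
    rw [Polynomial.eval_mul, Polynomial.eval_C, Polynomial.eval_pow, Polynomial.eval_X, mul_comm]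
  by_cases hi : i < g.totalDegree + 1
  · have := congr_arg (Polynomial.coeff · i) hP
    simpa [P, Polynomial.finsetSum_coeff, Polynomial.coeff_C_mul, Polynomial.coeff_X_pow, hi,
      Nat.lt_succ_iff.mp hi] using this
  · rw [homogeneousComponent_eq_zero _ _ (by omega), map_zero]

variable {ι : Type*} {lam : d.Partition} {ℓ : MvPolynomial (Fin (d + 1)) K}
  {a : Fin (d + 1) → MvPolynomial ι K}

/-- The factor ℓ makes the degree positive even for n = 0, as the description of basic opens
requires; the fraction (ℓ g)/ℓ^(n+1) is again g/ℓ^n. -/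
lemma mul_mem_awayι_iff (hℓ : ℓ ∈ grading K d 1) {n : ℕ} {g : MvPolynomial (Fin (d + 1)) K}
    (hg : g ∈ grading K d (n • 1)) (y : Spec (.of (Away (grading K d) ℓ))) :
    ℓ * g ∈ (Proj.awayι (grading K d) ℓ hℓ one_pos y).asHomogeneousIdeal ↔
      Away.mk (grading K d) hℓ n g hg ∈ y.asIdeal := by
  have hg' : ℓ * g ∈ grading K d (n + 1) := by
    have := SetLike.mul_mem_graded hℓ hg
    rwa [smul_eq_mul, mul_one, add_comm 1 n] at this
  have h := congr_arg (fun U => y ∈ U)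
    (Proj.awayι_preimage_basicOpen (grading K d) hℓ one_pos hg' n.succ_pos)
  have h2 : Away.isLocalizationElem hℓ hg' = Away.mk (grading K d) hℓ n g hg := by
    apply HomogeneousLocalization.val_injective
    rw [Away.val_mk, Away.val_mk, Localization.mk_eq_mk_iff, Localization.r_iff_exists]
    exact ⟨1, by simp; ring⟩
  rw [h2] at h
  exact not_iff_not.mp (iff_of_eq h)

/-- A fraction g/ℓ^n is in the kernel iff g vanishes on all parametrized points. By `surj` these
are, up to scaling, all points of the cone with ℓ ≠ 0, so then ℓ g vanishes on the entire cone. -/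
lemma awayι_preimage_locus [Infinite K] (hℓ : ℓ ∈ grading K d 1) (ha : aeval a ℓ = 1)
    (mem : ∀ c : ι → K, (fun j => eval c (a j)) ∈ coneOver K lam)
    (surj : ∀ b ∈ coneOver K lam, eval b ℓ ≠ 0 → ∃ (s : K) (c : ι → K),
      b = s • fun j => eval c (a j)) :
    Proj.awayι (grading K d) ℓ hℓ one_pos ⁻¹' (locus K lam : Set (projSpace K d)) =
      PrimeSpectrum.zeroLocus (RingHom.ker (evalAway ha)) := by
  have hcomp (g : MvPolynomial (Fin (d + 1)) K) (c : ι → K) :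
      eval c (aeval a g) = aeval (fun j => eval c (a j)) g := by
    have := congr_arg (fun φ : _ →ₐ[K] K => φ g)
      (MvPolynomial.comp_aeval (σ := Fin (d + 1)) (R := K) a (aeval c : _ →ₐ[K] K))
    simpa [aeval_eq_eval] using this
  ext y
  change (vanishingIdeal K (coneOver K lam) : Set (MvPolynomial (Fin (d + 1)) K)) ⊆
    (Proj.awayι (grading K d) ℓ hℓ one_pos y).asHomogeneousIdeal ↔
    ((RingHom.ker (evalAway ha) : Ideal (Away (grading K d) ℓ)) : Set (Away (grading K d) ℓ)) ⊆
      (y.asIdeal : Set (Away (grading K d) ℓ))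
  constructor
  · intro hV x hx
    obtain ⟨n, g, hg, rfl⟩ := Away.mk_surjective _ hℓ x
    rw [SetLike.mem_coe, RingHom.mem_ker, evalAway_mk] at hx
    rw [SetLike.mem_coe, ← mul_mem_awayι_iff]
    apply hV
    rw [SetLike.mem_coe, mem_vanishingIdeal_iff]
    intro b hb
    rw [map_mul]
    by_cases hb0 : eval b ℓ = 0
    · rw [aeval_eq_eval, hb0, zero_mul]
    · obtain ⟨s, c, rfl⟩ := surj b hb hb0
      rw [aeval_smul_of_isHomogeneous (g := g) (n := n) (by simpa using hg), ← hcomp g, hx]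
      simp
  · intro hk g hg
    have hp := (Proj.awayι (grading K d) ℓ hℓ one_pos y).isPrime
    have hℓy : ℓ ∉ (Proj.awayι (grading K d) ℓ hℓ one_pos y).asHomogeneousIdeal := by
      have h1 : Proj.awayι (grading K d) ℓ hℓ one_pos y ∈
        (Proj.awayι (grading K d) ℓ hℓ one_pos).opensRange := ⟨y, rfl⟩
      rwa [Proj.opensRange_awayι] at h1
    rw [← sum_homogeneousComponent g]
    refine sum_mem fun i _ => ?_
    have hi := homogeneousComponent_mem_vanishingIdeal
      (fun x hx s hs => smul_mem_coneOver hx hs) hg i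
    have hi' : homogeneousComponent i g ∈ grading K d (i • 1) := by
      simpa using homogeneousComponent_isHomogeneous i g
    refine (hp.mem_or_mem ((mul_mem_awayι_iff hℓ hi' y).mpr (hk ?_))).resolve_left hℓy
    rw [SetLike.mem_coe, RingHom.mem_ker, evalAway_mk]
    refine MvPolynomial.funext fun c => ?_
    rw [hcomp, map_zero]
    exact mem_vanishingIdeal_iff.mp hi _ (mem c)

end Locus

/-- Both C and D are the quotient of A by the common kernel, so they are isomorphic as K-algebras.
-/
lemma smooth_comp_iff_of_ker_eq {K A B C : Type*} [CommRing K] [CommRing A] [CommRing B]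
    [CommRing C] [Algebra K B] {κ : K →+* A} {ψ : A →+* C} {φ : A →+* B}
    (hψ : Function.Surjective ψ) (hκ : φ.comp κ = algebraMap K B)
    (hker : RingHom.ker ψ = RingHom.ker φ) {D : Subalgebra K B}
    (hD : ∀ b, b ∈ φ.range ↔ b ∈ D) : (ψ.comp κ).Smooth ↔ Algebra.Smooth K D := by
  let := κ.toAlgebra
  let := (ψ.comp κ).toAlgebra
  let ψ' : A →ₐ[K] C := { ψ with commutes' := fun _ => rfl }
  let φ' : A →ₐ[K] B := { φ with commutes' := fun r => RingHom.congr_fun hκ r }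
  let φ'' : A →ₐ[K] D := φ'.codRestrict D fun x => (hD _).mp ⟨x, rfl⟩
  have hφ : Function.Surjective φ'' := by
    rintro ⟨b, hb⟩
    obtain ⟨x, hx⟩ := (hD b).mpr hb
    exact ⟨x, Subtype.ext hx⟩
  have hk : RingHom.ker ψ' = RingHom.ker φ'' := by
    ext x
    have := congr_arg (fun I => x ∈ I) hker
    simp only [RingHom.mem_ker, eq_iff_iff] at this ⊢
    exact this.trans ⟨fun h => Subtype.ext h, fun h => congr_arg Subtype.val h⟩
  let e : C ≃ₐ[K] D := (Ideal.quotientKerAlgEquivOfSurjective (f := ψ') hψ).symm.trans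
    ((Ideal.quotientEquivAlgOfEq K hk).trans (Ideal.quotientKerAlgEquivOfSurjective (f := φ'') hφ))
  exact ⟨fun h => @Algebra.Smooth.of_equiv K _ C D _ _ _ _ h e, fun h => Algebra.Smooth.of_equiv e.symm⟩

end

section

open HomogeneousLocalization MvPolynomial

/-! ### Smoothness of the locus in terms of its charts -/

section SubschemeChart

variable {X : Scheme.{u}} (I : X.IdealSheafData) (U : X.affineOpens)

/-- The open immersion of the spectrum of `Γ(X, U) ⧸ I(U)` into the closed subscheme defined by
the ideal sheaf `I`. -/
def subschemeChart : Spec (.of (Γ(X, U) ⧸ I.ideal U)) ⟶ I.subscheme :=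
  I.subschemeCover.f U

instance : IsOpenImmersion (subschemeChart I U) :=
  I.subschemeCover.map_prop U

/-- The restriction of functions from the affine open `U` to its intersection with the closed
subscheme defined by the ideal sheaf `I`. -/
def quotientSection : Γ(X, U) ⟶ .of (Γ(X, U) ⧸ I.ideal U) :=
  CommRingCat.ofHom (Ideal.Quotient.mk (I.ideal U))

lemma quotientSection_surjective : Function.Surjective (quotientSection I U).hom :=
  Ideal.Quotient.mk_surjective

lemma quotientSection_eq_zero_iff (x : Γ(X, U)) :
    (quotientSection I U).hom x = 0 ↔ x ∈ I.ideal U :=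
  Ideal.Quotient.eq_zero_iff_mem

lemma subschemeChart_comp_subschemeι :
    subschemeChart I U ≫ I.subschemeι = Spec.map (quotientSection I U) ≫ U.2.fromSpec :=
  (I.subschemeCover_map_subschemeι U).trans (I.glueDataObjι_ι U)

lemma opensRange_subschemeChart :
    (subschemeChart I U).opensRange = I.subschemeι ⁻¹ᵁ U :=
  I.opensRange_subschemeCover_map U

lemma smooth_of_subschemeCharts {S : Scheme.{u}} (π : I.subscheme ⟶ S) {J : Type u}
    (U : J → X.affineOpens) (hU : ⨆ i, (U i : X.Opens) = ⊤)
    (h : ∀ i, Smooth (subschemeChart I (U i) ≫ π)) : Smooth π := by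
  have hx (x : I.subscheme) : ∃ i, I.subschemeι x ∈ (U i : X.Opens) :=
    TopologicalSpace.Opens.mem_iSup.mp (hU.ge (Set.mem_univ (I.subschemeι x)))
  choose idx hidx using hx
  let 𝒰 : I.subscheme.AffineOpenCover :=
    { I₀ := J
      X := fun i => .of (Γ(X, U i) ⧸ I.ideal (U i))
      f := fun i => subschemeChart I (U i)
      idx := idx
      covers := fun x => (opensRange_subschemeChart I (U (idx x))).ge (hidx x)
      map_prop := fun i => inferInstanceAs (IsOpenImmersion (subschemeChart I (U i))) }
  have : IsZariskiLocalAtSource @Smooth.{u} :=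
    HasRingHomProperty.instIsZariskiLocalAtSource (P := @Smooth.{u}) (Q := RingHom.Smooth)
  exact (IsZariskiLocalAtSource.iff_of_openCover (P := @Smooth.{u}) 𝒰.openCover).mpr h

end SubschemeChart

variable {K : Type u} [Field K] {d : ℕ} {ι : Type*} {lam : d.Partition}
  {ℓ : MvPolynomial (Fin (d + 1)) K} {a : Fin (d + 1) → MvPolynomial ι K}

/-- The affine chart of the coincident root locus on which the linear form `ℓ` is nonzero. -/
abbrev chart (lam : d.Partition) (hℓ : ℓ ∈ grading K d 1) :=
  subschemeChart (Scheme.IdealSheafData.vanishingIdeal (locus K lam))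
    (affineBasicOpen (grading K d) hℓ one_pos)

lemma chart_comp_toSpec (hℓ : ℓ ∈ grading K d 1) :
    chart lam hℓ ≫ coincidentRootLocusToSpec K lam =
      Spec.map (CommRingCat.ofHom (constAway ℓ) ≫ Proj.awayToSection (grading K d) ℓ ≫
        quotientSection (Scheme.IdealSheafData.vanishingIdeal (locus K lam))
          (affineBasicOpen (grading K d) hℓ one_pos)) := by
  refine (Category.assoc _ _ _).symm.trans ?_
  refine (congr_arg (· ≫ projSpaceToSpec K d) (subschemeChart_comp_subschemeι _ _)).trans ?_
  dsimp only
  rw [fromSpec_basicOpen_eq (grading K d) hℓ one_pos, projSpaceToSpec, Category.assoc, Category.assoc,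
    Proj.awayι_toSpecZero_assoc]
  rw [← Spec.map_comp, ← Spec.map_comp, ← Spec.map_comp]
  rfl

lemma smooth_chart_iff [Infinite K] (hℓ : ℓ ∈ grading K d 1) (ha : aeval a ℓ = 1)
    (mem : ∀ c : ι → K, (fun j => eval c (a j)) ∈ coneOver K lam)
    (surj : ∀ b ∈ coneOver K lam, eval b ℓ ≠ 0 → ∃ (s : K) (c : ι → K),
      b = s • fun j => eval c (a j)) :
    Smooth (chart lam hℓ ≫ coincidentRootLocusToSpec K lam) ↔
      Algebra.Smooth K (Algebra.adjoin K (Set.range a)) := by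
  have hiso : IsIso (Proj.awayToSection (grading K d) ℓ) := by
    rw [← Proj.basicOpenIsoAway_hom (grading K d) ℓ hℓ one_pos]; infer_instance
  rw [chart_comp_toSpec, HasRingHomProperty.Spec_iff (P := @Smooth), CommRingCat.hom_comp]
  refine smooth_comp_iff_of_ker_eq (φ := evalAway ha) ?_ (evalAway_comp_constAway ha) ?_
    (mem_range_evalAway ha hℓ)
  · exact (quotientSection_surjective _ _).comp
      ((ConcreteCategory.isIso_iff_bijective _).mp hiso).surjective
  · ext x
    rw [RingHom.mem_ker, CommRingCat.hom_comp, RingHom.comp_apply, quotientSection_eq_zero_iff]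
    refine (mem_vanishingIdeal_affineBasicOpen (grading K d) hℓ one_pos (locus K lam) x).trans ?_
    refine (iff_of_eq (congr_arg (fun T => x ∈ PrimeSpectrum.vanishingIdeal T)
      (awayι_preimage_locus hℓ ha mem surj))).trans ?_
    rw [PrimeSpectrum.vanishingIdeal_zeroLocus_eq_radical,
      (RingHom.ker_isPrime _).isRadical.radical]

/-- The coincident root locus is smooth if all its charts in a cover of projective space are
smooth. -/
lemma smooth_of_charts {J : Type u} (L : J → MvPolynomial (Fin (d + 1)) K)
    (hL : ∀ i, L i ∈ grading K d 1)
    (hspan : ∀ j, X j ∈ Ideal.span (Set.range L))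
    (h : ∀ i, Smooth (chart lam (hL i) ≫ coincidentRootLocusToSpec K lam)) :
    Smooth (coincidentRootLocusToSpec K lam) := by
  have hcov : ⨆ i, Proj.basicOpen (grading K d) (L i) = ⊤ := by
    refine Proj.iSup_basicOpen_eq_top _ _ fun p hp => ?_
    -- The irrelevant ideal is generated by the variables, and these lie in the span of the L i.
    have hp0 : p ∈ idealOfVars (Fin (d + 1)) K := by
      rw [← pow_one (idealOfVars _ _), mem_pow_idealOfVars_iff']
      intro x hx
      have h0 : homogeneousComponent 0 p = 0 := by
        rw [← decomposition.decompose'_apply]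
        exact (HomogeneousIdeal.mem_irrelevant_iff _ _).mp hp
      rw [homogeneousComponent_zero, C_eq_zero] at h0
      rwa [(Finsupp.degree_eq_zero_iff x).mp (by omega)]
    refine Ideal.span_le.mpr ?_ hp0
    rintro _ ⟨j, rfl⟩
    exact hspan j
  exact smooth_of_subschemeCharts _ _
    (fun i => affineBasicOpen (grading K d) (hL i) one_pos) hcov h

end

section

open Polynomial

/-! ### Binary forms as polynomials in one variable -/

section Dehomogenize

/-- By homogeneity G vanishes wherever x ≠ 0, so x G vanishes at every point and is zero since K is
infinite. -/
lemma eq_zero_of_isHomogeneous_of_aeval_eq_zero {K : Type*} [Field K] [Infinite K]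
    {G : MvPolynomial (Fin 2) K} {n : ℕ} (hG : G.IsHomogeneous n)
    (h : MvPolynomial.aeval ![(1 : K[X]), X] G = 0) : G = 0 := by
  have key : MvPolynomial.X 0 * G = 0 := by
    refine MvPolynomial.funext fun x => ?_
    rw [map_mul, MvPolynomial.eval_X, map_zero]
    by_cases hx : x 0 = 0
    · rw [hx, zero_mul]
    · have h1 := congr_arg (Polynomial.aeval (x 1 / x 0)) h
      have h2 : (Polynomial.aeval (x 1 / x 0)) (MvPolynomial.aeval ![(1 : K[X]), X] G) =
          MvPolynomial.aeval ![1, x 1 / x 0] G := by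
        rw [← AlgHom.comp_apply, MvPolynomial.comp_aeval]
        congr 2
        ext i
        fin_cases i <;> simp
      have h3 : x = x 0 • ![1, x 1 / x 0] := by
        ext i
        fin_cases i
        · simp
        · simp [mul_div_cancel₀ _ hx]
      rw [h2, map_zero] at h1
      rw [← MvPolynomial.aeval_eq_eval, h3, aeval_smul_of_isHomogeneous hG, h1]
      simp
  exact (mul_eq_zero.mp key).resolve_left (MvPolynomial.X_ne_zero 0)

variable {K : Type u} [Field K] {d : ℕ}

lemma isHomogeneous_binaryForm (a : Fin (d + 1) → K) : (binaryForm K a).IsHomogeneous d := by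
  refine MvPolynomial.IsHomogeneous.sum _ _ _ fun j _ => ?_
  have := ((MvPolynomial.isHomogeneous_C (Fin 2) (a j)).mul
    ((MvPolynomial.isHomogeneous_X K (0 : Fin 2)).pow (d - j))).mul
    ((MvPolynomial.isHomogeneous_X K (1 : Fin 2)).pow (j : ℕ))
  convert this using 1
  omega

lemma aeval_binaryForm (a : Fin (d + 1) → K) :
    MvPolynomial.aeval ![(1 : K[X]), X] (binaryForm K a) = ∑ j : Fin (d + 1), C (a j) * X ^ (j : ℕ) := by
  simp [binaryForm]

lemma sum_C_coeff_mul_X_pow {R : Type*} [CommRing R] {f : R[X]} (hf : f.natDegree ≤ d) :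
    ∑ j : Fin (d + 1), C (f.coeff j) * X ^ (j : ℕ) = f := by
  rw [Fin.sum_univ_eq_sum_range (fun j => C (f.coeff j) * X ^ j),
    ← f.as_sum_range_C_mul_X_pow' (Nat.lt_succ_of_le hf)]

lemma mem_Icc_of_mem_parts {d : ℕ} {lam : d.Partition} {r : ℕ} (hr : r ∈ lam.parts) :
    r ∈ Finset.Icc 1 d :=
  Finset.mem_Icc.mpr ⟨lam.parts_pos hr, by
    conv_rhs => rw [← lam.parts_sum]
    exact Multiset.single_le_sum (fun _ _ => Nat.zero_le _) r hr⟩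

lemma sum_count_mul (lam : d.Partition) :
    ∑ r ∈ Finset.Icc 1 d, lam.parts.count r * r = d := by
  conv_rhs => rw [← lam.parts_sum, Finset.sum_multiset_count]
  refine (Finset.sum_subset (fun r hr => ?_) fun r _ hr => ?_).symm
  · rw [Multiset.mem_toFinset] at hr
    rw [Finset.mem_Icc]
    exact ⟨lam.parts_pos hr, by
      conv_rhs => rw [← lam.parts_sum]
      exact Multiset.single_le_sum (fun _ _ => Nat.zero_le _) r hr⟩
  · rw [Multiset.mem_toFinset] at hr
    rw [Multiset.count_eq_zero_of_notMem hr, zero_mul]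

/-- Setting x = 1 loses factors x of G r, which is why the degree of g r is only bounded by the
multiplicity. -/
lemma mem_coneOver_iff [Infinite K] {lam : d.Partition} {a : Fin (d + 1) → K} :
    a ∈ coneOver K lam ↔ ∃ (c : Kˣ) (g : ℕ → K[X]),
      (∀ r ∈ Finset.Icc 1 d, g r ≠ 0 ∧ (g r).natDegree ≤ lam.parts.count r) ∧
      ∑ j : Fin (d + 1), C (a j) * X ^ (j : ℕ) = C (c : K) * ∏ r ∈ Finset.Icc 1 d, g r ^ r := by
  constructor
  · rintro ⟨c, G, hG, h⟩
    refine ⟨c, fun r => MvPolynomial.aeval ![(1 : K[X]), X] (G r), fun r hr => ⟨fun h0 =>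
      (hG r hr).1 (eq_zero_of_isHomogeneous_of_aeval_eq_zero (hG r hr).2 h0), ?_⟩, ?_⟩
    · have := MvPolynomial.aeval_natDegree_le (G r) (hG r hr).2.totalDegree_le ![(1 : K[X]), X]
        (n := 1) (by intro i; fin_cases i <;> simp)
      simpa using this
    · rw [← aeval_binaryForm, h]
      simp [map_prod, MvPolynomial.algHom_C]
  · rintro ⟨c, g, hg, h⟩
    let G : ℕ → MvPolynomial (Fin 2) K := fun r =>
      binaryForm K (d := lam.parts.count r) fun j => (g r).coeff j
    have hG (r) (hr : r ∈ Finset.Icc 1 d) : MvPolynomial.aeval ![(1 : K[X]), X] (G r) = g r := by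
      rw [aeval_binaryForm, sum_C_coeff_mul_X_pow (hg r hr).2]
    have hprod : (∏ r ∈ Finset.Icc 1 d, G r ^ r).IsHomogeneous d := by
      have := MvPolynomial.IsHomogeneous.prod (Finset.Icc 1 d) (fun r => G r ^ r)
        (fun r => lam.parts.count r * r) fun r _ => (isHomogeneous_binaryForm _).pow r
      rwa [sum_count_mul] at this
    refine ⟨c, G, fun r hr => ⟨fun h0 => (hg r hr).1 ?_, isHomogeneous_binaryForm _⟩, ?_⟩
    · rw [← hG r hr, h0, map_zero]
    · rw [← sub_eq_zero]
      refine eq_zero_of_isHomogeneous_of_aeval_eq_zero (n := d)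
        ((isHomogeneous_binaryForm a).sub ?_) ?_
      · simpa using (MvPolynomial.isHomogeneous_C (Fin 2) (c : K)).mul hprod
      · rw [map_sub, aeval_binaryForm, h, sub_eq_zero, map_mul, map_prod, MvPolynomial.algHom_C]
        congr 1
        exact Finset.prod_congr rfl fun r hr => by rw [map_pow, hG r hr]

end Dehomogenize

/-! ### The charts of forms not vanishing at (1, t) -/

section PolynomialChart

variable {K : Type u} [Field K] {d : ℕ}

/-- The linear form on binary forms of degree `d` whose value at a form is the value of that form
at `(1, t)`. -/
def valueAt (d : ℕ) (t : K) : MvPolynomial (Fin (d + 1)) K :=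
  ∑ j : Fin (d + 1), MvPolynomial.C (t ^ (j : ℕ)) * MvPolynomial.X j

lemma valueAt_mem (t : K) : valueAt d t ∈ grading K d 1 := by
  refine MvPolynomial.IsHomogeneous.sum _ _ _ fun j _ => ?_
  simpa using (MvPolynomial.isHomogeneous_C (Fin (d + 1)) (t ^ (j : ℕ))).mul
    (MvPolynomial.isHomogeneous_X K j)

lemma aeval_valueAt {B : Type*} [CommRing B] [Algebra K B] (a : Fin (d + 1) → B) (t : K) :
    MvPolynomial.aeval a (valueAt d t) =
      (∑ j : Fin (d + 1), C (a j) * X ^ (j : ℕ)).eval (algebraMap K B t) := by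
  rw [valueAt, map_sum, eval_finsetSum]
  refine Finset.sum_congr rfl fun j _ => ?_
  rw [map_mul, MvPolynomial.algHom_C, MvPolynomial.aeval_X, eval_mul, eval_C, eval_pow, eval_X,
    map_pow, mul_comm]

/-- Evaluation at d + 1 distinct points determines the coefficients, by inverting a Vandermonde
matrix. Hence the charts cover projective space. -/
lemma X_mem_span_valueAt [Infinite K] (j : Fin (d + 1)) :
    MvPolynomial.X j ∈ Ideal.span (Set.range (valueAt (K := K) d)) := by
  let v : Fin (d + 1) → K := fun i => Infinite.natEmbedding K i
  have hv : Function.Injective v := (Infinite.natEmbedding K).injective.comp Fin.val_injective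
  have hdet : IsUnit (Matrix.vandermonde v).det :=
    (Matrix.det_vandermonde_ne_zero_iff.mpr hv).isUnit
  have h : MvPolynomial.X j = ∑ i, MvPolynomial.C ((Matrix.vandermonde v)⁻¹ j i) *
      valueAt d (v i) := by
    have h1 := Matrix.nonsing_inv_mul _ hdet
    simp only [valueAt, Finset.mul_sum, ← mul_assoc, ← MvPolynomial.C_mul]
    rw [Finset.sum_comm]
    simp only [← Finset.sum_mul, ← map_sum]
    have h2 (k : Fin (d + 1)) : ∑ i, (Matrix.vandermonde v)⁻¹ j i * v i ^ (k : ℕ) =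
        (1 : Matrix (Fin (d + 1)) (Fin (d + 1)) K) j k := by
      rw [← h1, Matrix.mul_apply]; rfl
    simp only [h2, Matrix.one_apply]
    rw [Finset.sum_eq_single j] <;> simp +contextual [eq_comm]
  rw [h]
  exact Ideal.sum_mem _ fun i _ => Ideal.mul_mem_left _ _ (Ideal.subset_span ⟨v i, rfl⟩)

/-- Both directions of the theorem rest on this criterion. In `surj` the factors may be normalized
to have value 1 at t, because the cone is only considered up to scalars. -/
lemma smooth_chart_valueAt_iff [Infinite K] {ι : Type*} {lam : d.Partition} {t : K}
    {f : (MvPolynomial ι K)[X]} (hf : f.natDegree ≤ d) (hft : f.eval (MvPolynomial.C t) = 1)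
    (mem : ∀ c : ι → K, ∃ g : ℕ → K[X],
      (∀ r ∈ Finset.Icc 1 d, g r ≠ 0 ∧ (g r).natDegree ≤ lam.parts.count r) ∧
      f.map (MvPolynomial.eval c) = ∏ r ∈ Finset.Icc 1 d, g r ^ r)
    (surj : ∀ g : ℕ → K[X],
      (∀ r ∈ Finset.Icc 1 d, (g r).eval t = 1 ∧ (g r).natDegree ≤ lam.parts.count r) →
      ∃ c : ι → K, ∏ r ∈ Finset.Icc 1 d, g r ^ r = f.map (MvPolynomial.eval c)) :
    Smooth (chart lam (valueAt_mem (d := d) t) ≫ coincidentRootLocusToSpec K lam) ↔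
      Algebra.Smooth K (Algebra.adjoin K (Set.range fun j : Fin (d + 1) => f.coeff j)) := by
  refine smooth_chart_iff (valueAt_mem t) ?_ (fun c => ?_) fun b hb hbt => ?_
  · rw [aeval_valueAt, sum_C_coeff_mul_X_pow hf]
    exact hft
  · obtain ⟨g, hg, h⟩ := mem c
    refine mem_coneOver_iff.mpr ⟨1, g, hg, ?_⟩
    rw [← h, Units.val_one, C_1, one_mul,
      ← sum_C_coeff_mul_X_pow (natDegree_map_le.trans hf)]
    simp
  · obtain ⟨s, g, hg, h⟩ := mem_coneOver_iff.mp hb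
    rw [← MvPolynomial.aeval_eq_eval, aeval_valueAt, h, Algebra.algebraMap_self_apply, eval_mul,
      eval_prod, mul_ne_zero_iff, Finset.prod_ne_zero_iff] at hbt
    have hgt (r) (hr : r ∈ Finset.Icc 1 d) : (g r).eval t ≠ 0 := by
      have := hbt.2 r hr
      rw [eval_pow] at this
      exact ne_zero_pow (by have := Finset.mem_Icc.mp hr; omega) this
    obtain ⟨c, hc⟩ := surj (fun r => C ((g r).eval t)⁻¹ * g r) fun r hr => ⟨by
      rw [eval_mul, eval_C, inv_mul_cancel₀ (hgt r hr)],
      (natDegree_C_mul_le _ _).trans (hg r hr).2⟩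
    let u : K := s * ∏ r ∈ Finset.Icc 1 d, (g r).eval t ^ r
    have hu : ∑ j : Fin (d + 1), C (b j) * X ^ (j : ℕ) = C u * f.map (MvPolynomial.eval c) := by
      rw [h, ← hc, C_mul, mul_assoc, map_prod, ← Finset.prod_mul_distrib]
      congr 1
      refine Finset.prod_congr rfl fun r hr => ?_
      rw [mul_pow, ← mul_assoc, ← C_pow, ← C_mul, ← mul_pow, mul_inv_cancel₀ (hgt r hr)]
      simp
    refine ⟨u, c, _root_.funext fun j => ?_⟩
    have := congr_arg (coeff · (j : ℕ)) hu
    simp only [finsetSum_coeff, coeff_C_mul, coeff_X_pow, coeff_map] at this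
    rw [Finset.sum_eq_single j] at this
    · simpa using this
    · intro i _ hi
      rw [if_neg (fun h => hi (Fin.ext h.symm)), mul_zero]
    · simp

end PolynomialChart

end

section

open Polynomial

/-! ### Equal parts: every chart is an affine space -/

section Even

variable {K : Type u} [Field K]

/-- The generic polynomial of degree `e` with value `1` at `0`. -/
def genericPoly (K : Type u) [Field K] (e : ℕ) : (MvPolynomial (Fin e) K)[X] :=
  1 + ∑ i : Fin e, C (MvPolynomial.X i) * X ^ ((i : ℕ) + 1)

lemma natDegree_genericPoly_le (e : ℕ) : (genericPoly K e).natDegree ≤ e := by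
  refine (natDegree_add_le _ _).trans (max_le (by simp) (natDegree_sum_le_of_forall_le _ _ ?_))
  intro i _
  exact (natDegree_C_mul_X_pow_le _ _).trans (by omega)

lemma coeff_genericPoly_zero (e : ℕ) : (genericPoly K e).coeff 0 = 1 := by
  simp [genericPoly, finsetSum_coeff, coeff_X_pow]

lemma coeff_genericPoly_succ {e : ℕ} (i : Fin e) :
    (genericPoly K e).coeff (i + 1) = MvPolynomial.X i := by
  rw [genericPoly, coeff_add, coeff_one, if_neg (by omega), zero_add, finsetSum_coeff,
    Finset.sum_eq_single i]
  · simp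
  · intro j _ hj
    rw [coeff_C_mul, coeff_X_pow, if_neg (fun h => hj (Fin.ext (by omega))), mul_zero]
  · simp

/-- If `g` has constant coefficient `1` then the `k`-th coefficient of `g ^ m` is `m * g.coeff k`
plus an element of the algebra generated by the lower coefficients of `g`. -/
lemma coeff_pow_sub_mem {B : Type*} [CommRing B] (S : Subring B) (g : B[X])
    (h0 : g.coeff 0 = 1) (k : ℕ) (hk : 0 < k) (hS : ∀ i < k, g.coeff i ∈ S) (m : ℕ) :
    (∀ i < k, (g ^ m).coeff i ∈ S) ∧ (g ^ m).coeff k - m * g.coeff k ∈ S := by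
  have h0m (m : ℕ) : (g ^ m).coeff 0 = 1 := by
    rw [coeff_zero_eq_eval_zero, eval_pow, ← coeff_zero_eq_eval_zero, h0, one_pow]
  induction m with
  | zero =>
    simp only [pow_zero, coeff_one, Nat.cast_zero, zero_mul, sub_zero]
    refine ⟨fun i _ => ?_, ?_⟩ <;> split_ifs <;> simp
  | succ m ih =>
    refine ⟨fun i hi => ?_, ?_⟩
    · rw [pow_succ, coeff_mul]
      refine sum_mem fun p hp => mul_mem (ih.1 _ ?_) (hS _ ?_) <;>
      · have := Finset.HasAntidiagonal.mem_antidiagonal.mp hp; omega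
    -- The two extreme terms of the convolution are the top coefficients of g and of g ^ m, each
    -- times 1; all other terms involve lower coefficients only.
    · obtain ⟨k, rfl⟩ : ∃ j, k = j + 1 := ⟨k - 1, by omega⟩
      rw [pow_succ, coeff_mul, Finset.Nat.sum_antidiagonal_succ, h0m,
        ← Finset.add_sum_erase _ _ (Finset.HasAntidiagonal.mem_antidiagonal.mpr
          (show (k, 0).1 + (k, 0).2 = k from rfl)), h0]
      have hrest : ∑ p ∈ (Finset.HasAntidiagonal.antidiagonal k).erase (k, 0),
          (g ^ m).coeff (p.1 + 1) * g.coeff p.2 ∈ S := by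
        refine sum_mem fun p hp => ?_
        obtain ⟨hne, hp⟩ := Finset.mem_erase.mp hp
        have hsum := Finset.HasAntidiagonal.mem_antidiagonal.mp hp
        have hp2 : p.2 ≠ 0 := fun h => hne (Prod.ext (by simp; omega) h)
        exact mul_mem (ih.1 _ (by omega)) (hS _ (by omega))
      convert add_mem ih.2 hrest using 1
      push_cast
      ring

lemma coeff_taylor_mem {B : Type*} [CommRing B] (S : Subring B) {f : B[X]}
    (hf : ∀ i, f.coeff i ∈ S) {r : B} (hr : r ∈ S) (i : ℕ) : (taylor r f).coeff i ∈ S := by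
  obtain ⟨q, rfl⟩ := (lifts_iff_coeff_lifts (f := S.subtype) f).mpr fun n => ⟨⟨_, hf n⟩, rfl⟩
  have : taylor r (q.map S.subtype) = (taylor ⟨r, hr⟩ q).map S.subtype := by
    simp [taylor_apply, map_comp]
  simp only [coe_mapRingHom]
  rw [this, coeff_map]
  exact Subtype.property _

/-- Translation by a constant does not change the algebra generated by the coefficients. By
`coeff_pow_sub_mem` and division by m, it then contains the coefficients of the generic polynomial,
which are the variables. -/
lemma adjoin_coeff_genericPoly_pow [CharZero K] {d e m : ℕ} (hm : m ≠ 0) (he : m * e ≤ d) (t : K) :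
    Algebra.adjoin K (Set.range fun j : Fin (d + 1) =>
      (taylor (MvPolynomial.C (-t)) (genericPoly K e ^ m)).coeff j) = ⊤ := by
  set S := Algebra.adjoin K (Set.range fun j : Fin (d + 1) =>
      (taylor (MvPolynomial.C (-t)) (genericPoly K e ^ m)).coeff j)
  have hdeg : (genericPoly K e ^ m).natDegree ≤ d :=
    (natDegree_pow_le_of_le m (natDegree_genericPoly_le e)).trans he
  have h1 (i : ℕ) : (taylor (MvPolynomial.C (-t)) (genericPoly K e ^ m)).coeff i ∈ S := by
    by_cases hi : i < d + 1
    · exact Algebra.subset_adjoin ⟨⟨i, hi⟩, rfl⟩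
    · rw [coeff_eq_zero_of_natDegree_lt (by rw [natDegree_taylor]; omega)]
      exact zero_mem S
  have h2 (i : ℕ) : (genericPoly K e ^ m).coeff i ∈ S := by
    have := coeff_taylor_mem S.toSubring h1 (r := MvPolynomial.C t) (S.algebraMap_mem t) i
    rwa [taylor_taylor, map_neg, add_neg_cancel, taylor_zero] at this
  have h3 (k : ℕ) : (genericPoly K e).coeff k ∈ S := by
    induction k using Nat.strong_induction_on with
    | _ k ih =>
      rcases Nat.eq_zero_or_pos k with rfl | hk
      · rw [coeff_genericPoly_zero]; exact one_mem S
      · have h4 := sub_mem (h2 k) (coeff_pow_sub_mem S.toSubring (genericPoly K e)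
          (coeff_genericPoly_zero e) k hk ih m).2
        rw [sub_sub_cancel] at h4
        have h5 := S.smul_mem h4 (m : K)⁻¹
        rwa [← nsmul_eq_mul, ← Nat.cast_smul_eq_nsmul K, smul_smul,
          inv_mul_cancel₀ (Nat.cast_ne_zero.mpr hm), one_smul] at h5
  rw [eq_top_iff, ← MvPolynomial.adjoin_range_X]
  refine Algebra.adjoin_le ?_
  rintro _ ⟨i, rfl⟩
  rw [← coeff_genericPoly_succ]
  exact h3 _

lemma smooth_of_isEven [CharZero K] {d : ℕ} (hd : 0 < d) {lam : d.Partition} (h : IsEven lam) :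
    Smooth (coincidentRootLocusToSpec K lam) := by
  obtain ⟨m, hm⟩ : ∃ m, m ∈ lam.parts := by
    by_contra! hcon
    have := lam.parts_sum
    rw [Multiset.eq_zero_of_forall_notMem hcon] at this
    simp at this; omega
  have hm0 : m ≠ 0 := (lam.parts_pos hm).ne'
  set e := lam.parts.count m with he
  have hcount (r : ℕ) (hr : r ≠ m) : lam.parts.count r = 0 :=
    Multiset.count_eq_zero_of_notMem fun hr' => hr (h r hr' m hm)
  have hmd : m ∈ Finset.Icc 1 d := mem_Icc_of_mem_parts hm
  have hme : m * e = d := by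
    rw [← sum_count_mul lam, Finset.sum_eq_single m, mul_comm]
    · intro r _ hr
      rw [hcount r hr, zero_mul]
    · exact fun h => absurd hmd h
  refine smooth_of_charts (valueAt d) valueAt_mem X_mem_span_valueAt fun t => ?_
  have hmapt (c : Fin e → K) : (taylor (MvPolynomial.C (-t)) (genericPoly K e ^ m)).map
      (MvPolynomial.eval c) = taylor (-t) ((genericPoly K e).map (MvPolynomial.eval c)) ^ m := by
    simp [taylor_apply, map_comp]
  refine (smooth_chart_valueAt_iff (ι := Fin e)
    (f := taylor (MvPolynomial.C (-t)) (genericPoly K e ^ m)) ?_ ?_ (fun c => ?_)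
    fun g hg => ?_).mpr ?_
  · rw [natDegree_taylor]
    exact (natDegree_pow_le_of_le m (natDegree_genericPoly_le e)).trans hme.le
  · rw [taylor_eval, map_neg, add_neg_cancel, ← coeff_zero_eq_eval_zero, coeff_zero_eq_eval_zero,
      eval_pow, ← coeff_zero_eq_eval_zero, coeff_genericPoly_zero, one_pow]
  · refine ⟨fun r => if r = m then taylor (-t) ((genericPoly K e).map (MvPolynomial.eval c)) else 1,
      fun r hr => ?_, ?_⟩
    · dsimp only
      split_ifs with hrm
      · subst hrm
        refine ⟨fun h0 => ?_, ?_⟩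
        · have h1 := congr_arg (eval t) h0
          rw [taylor_eval, add_neg_cancel, ← coeff_zero_eq_eval_zero, coeff_map,
            coeff_genericPoly_zero] at h1
          simp at h1
        · rw [natDegree_taylor]
          exact natDegree_map_le.trans (natDegree_genericPoly_le e)
      · simp
    · rw [hmapt, Finset.prod_eq_single m]
      · simp
      · intro r _ hr
        simp [hr]
      · exact fun h => absurd hmd h
  · let c : Fin e → K := fun i => (taylor t (g m)).coeff (i + 1)
    refine ⟨c, ?_⟩
    have hgm : taylor t (g m) = (genericPoly K e).map (MvPolynomial.eval c) := by
      ext n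
      rw [coeff_map]
      rcases Nat.eq_zero_or_pos n with rfl | hn
      · rw [coeff_genericPoly_zero, map_one, taylor_coeff_zero, (hg m hmd).1]
      · obtain ⟨n, rfl⟩ : ∃ k, n = k + 1 := ⟨n - 1, by omega⟩
        by_cases hne : n < e
        · have := coeff_genericPoly_succ (K := K) (⟨n, hne⟩ : Fin e)
          rw [show (genericPoly K e).coeff (n + 1) = _ from this, MvPolynomial.eval_X]
        · rw [coeff_eq_zero_of_natDegree_lt, coeff_eq_zero_of_natDegree_lt, map_zero]
          · exact (natDegree_genericPoly_le e).trans_lt (by omega)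
          · rw [natDegree_taylor]
            exact (hg m hmd).2.trans_lt (by omega)
    rw [hmapt, ← hgm, taylor_taylor, neg_add_cancel, taylor_zero, Finset.prod_eq_single m]
    -- For r ≠ m the multiplicity is 0, so g r is a constant with value 1 at t.
    · intro r hr hrm
      have h1 := (hg r hr).2
      rw [hcount r hrm, Nat.le_zero] at h1
      obtain ⟨s, hs⟩ := natDegree_eq_zero.mp h1
      have h2 := (hg r hr).1
      rw [← hs, eval_C] at h2
      rw [← hs, h2, C_1, one_pow]
    · exact fun h => absurd hmd h
  · rw [adjoin_coeff_genericPoly_pow hm0 hme.le t]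
    have : Algebra.Smooth K (MvPolynomial (Fin e) K) := ⟨inferInstance, inferInstance⟩
    exact Algebra.Smooth.of_equiv (Subalgebra.topEquiv (R := K)
      (A := MvPolynomial (Fin e) K)).symm

end Even

end

/-! ### Algebraic independence from formal smoothness -/

section FormallySmooth

open MvPolynomial

variable {K : Type*} [Field K] {σ τ : Type*}

lemma map_mem_pow_idealOfVars (φ : MvPolynomial σ K →ₐ[K] MvPolynomial τ K)
    (hφ : ∀ i, φ (X i) ∈ idealOfVars τ K) {n : ℕ} {p : MvPolynomial σ K}
    (hp : p ∈ idealOfVars σ K ^ n) : φ p ∈ idealOfVars τ K ^ n := by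
  have h : (idealOfVars σ K).map φ ≤ idealOfVars τ K := by
    rw [Ideal.map_span, Ideal.span_le]
    rintro _ ⟨_, ⟨i, rfl⟩, rfl⟩
    exact hφ i
  have := Ideal.mem_map_of_mem φ hp
  rw [Ideal.map_pow] at this
  exact Ideal.pow_right_mono h n this

/-- An endomorphism that is the identity to first order acts as the identity on each quotient m^n /
m^(n+1). -/
lemma sub_mem_pow_idealOfVars (ψ : MvPolynomial τ K →ₐ[K] MvPolynomial τ K)
    (hψ : ∀ i, ψ (X i) - X i ∈ idealOfVars τ K ^ 2) {n : ℕ} {p : MvPolynomial τ K}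
    (hp : p ∈ idealOfVars τ K ^ n) : ψ p - p ∈ idealOfVars τ K ^ (n + 1) := by
  set m := idealOfVars τ K with hm
  have hX (i : τ) : X i ∈ m := Ideal.subset_span ⟨i, rfl⟩
  have hψX (i : τ) : ψ (X i) ∈ m := by
    have := add_mem (Ideal.pow_le_self two_ne_zero (hψ i)) (hX i)
    rwa [sub_add_cancel] at this
  have h0 (p : MvPolynomial τ K) : ψ p - p ∈ m := by
    rw [← Ideal.Quotient.mk_eq_mk_iff_sub_mem]
    have : (Ideal.Quotient.mkₐ K m).comp ψ = Ideal.Quotient.mkₐ K m := by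
      ext i
      simp only [AlgHom.comp_apply, Ideal.Quotient.mkₐ_eq_mk]
      rw [Ideal.Quotient.mk_eq_mk_iff_sub_mem]
      exact Ideal.pow_le_self two_ne_zero (hψ i)
    exact DFunLike.congr_fun this p
  have h1 {u : MvPolynomial τ K} (hu : u ∈ m) : ψ u - u ∈ m ^ 2 := by
    rw [hm, idealOfVars] at hu
    induction hu using Submodule.span_induction with
    | mem x hx => obtain ⟨i, rfl⟩ := hx; exact hψ i
    | zero => simp
    | add x y _ _ hx hy => rw [map_add, add_sub_add_comm]; exact add_mem hx hy
    | smul a x hx' hx =>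
      have e : ψ (a • x) - a • x = ψ a * (ψ x - x) + (ψ a - a) * x := by
        rw [smul_eq_mul, map_mul]; ring
      rw [e]
      refine add_mem (Ideal.mul_mem_left _ _ hx) ?_
      rw [pow_two]
      exact Ideal.mul_mem_mul (h0 a) hx'
  induction n generalizing p with
  | zero => simpa using h0 p
  | succ n ih =>
    rw [pow_succ'] at hp
    induction hp using Submodule.mul_induction_on' with
    | mem_mul_mem u hu v hv =>
      have e : ψ (u * v) - u * v = ψ u * (ψ v - v) + (ψ u - u) * v := by
        rw [map_mul]; ring
      rw [e]
      refine add_mem ?_ ?_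
      · rw [pow_succ' m (n + 1)]
        refine Ideal.mul_mem_mul ?_ (ih hv)
        simpa using map_mem_pow_idealOfVars ψ hψX (n := 1) (by simpa using hu)
      · rw [show n + 1 + 1 = 2 + n by ring, pow_add]
        exact Ideal.mul_mem_mul (h1 hu) hv
    | add x _ y _ hx hy => rw [map_add, add_sub_add_comm]; exact add_mem hx hy

/-- Elements of a formally smooth algebra which are mapped to the variables by some homomorphism to
the polynomial ring modulo the square of the ideal of the variables are algebraically
independent. -/
lemma algebraicIndependent_of_formallySmooth {D : Type*} [CommRing D] [Algebra K D]
    [Algebra.FormallySmooth K D] (y : τ → D)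
    (g : D →ₐ[K] MvPolynomial τ K ⧸ idealOfVars τ K ^ 2)
    (hg : ∀ i, g (y i) = Ideal.Quotient.mk _ (X i)) : AlgebraicIndependent K y := by
  rw [algebraicIndependent_iff]
  intro Q hQ
  let m := idealOfVars τ K
  -- A relation Q is shown to vanish to every order at the origin.
  suffices h : ∀ s, Q ∈ m ^ s by
    ext x
    rw [coeff_zero]
    exact (mem_pow_idealOfVars_iff' _ _).mp (h (x.degree + 1)) x (Nat.lt_succ_self _)
  intro s
  induction s with
  | zero => simp
  | succ s ih =>
    -- The exponent s + 2, rather than s + 1, allows g to be lifted from order 2 also when s = 0.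
    have hle : m ^ (s + 2) ≤ m ^ 2 := Ideal.pow_le_pow_right (by omega)
    let F := Ideal.Quotient.factorₐ K hle
    have hF : Function.Surjective F := Ideal.Quotient.factor_surjective hle
    have hnil : IsNilpotent (RingHom.ker F) := by
      refine ⟨s + 2, ?_⟩
      rw [Ideal.zero_eq_bot, eq_bot_iff]
      have hk : RingHom.ker F ≤ m.map (Ideal.Quotient.mk (m ^ (s + 2))) := by
        intro z hz
        obtain ⟨z, rfl⟩ := Ideal.Quotient.mk_surjective z
        have hz' : Ideal.Quotient.mk (m ^ 2) z = 0 := hz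
        rw [Ideal.Quotient.eq_zero_iff_mem] at hz'
        exact Ideal.mem_map_of_mem _ (Ideal.pow_le_self two_ne_zero hz')
      refine (Ideal.pow_right_mono hk _).trans ?_
      rw [← Ideal.map_pow, Ideal.map_quotient_self]
    let G := Algebra.FormallySmooth.liftOfSurjective g F hF hnil
    have hG (x : D) : F (G x) = g x := Algebra.FormallySmooth.liftOfSurjective_apply g F hF hnil x
    choose h hh using fun i => Ideal.Quotient.mk_surjective (G (y i))
    let ψ : MvPolynomial τ K →ₐ[K] MvPolynomial τ K := aeval h
    have hψ (i : τ) : ψ (X i) - X i ∈ m ^ 2 := by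
      rw [aeval_X, ← Ideal.Quotient.mk_eq_mk_iff_sub_mem]
      change F (Ideal.Quotient.mk _ (h i)) = _
      rw [hh, hG]
      exact hg i
    -- Modulo m^(s+2), ψ factors through D, where Q(y) = 0. As ψ Q and Q agree modulo m^(s+1), Q
    -- gains one order of vanishing.
    have hψQ : ψ Q ∈ m ^ (s + 2) := by
      rw [← Ideal.Quotient.eq_zero_iff_mem]
      have e : (Ideal.Quotient.mkₐ K (m ^ (s + 2))).comp ψ = G.comp (aeval y) := by
        ext i
        simp [ψ, hh]
      have := DFunLike.congr_fun e Q
      rw [AlgHom.comp_apply, AlgHom.comp_apply, hQ, map_zero] at this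
      exact this
    have := sub_mem (Ideal.pow_le_pow_right (show s + 1 ≤ s + 2 by omega) hψQ)
      (sub_mem_pow_idealOfVars ψ hψ ih)
    rwa [sub_sub_cancel] at this

/-- If no nonzero linear form in the variables `X (e i)` is the linear part of a relation between
the generators `x` of a formally smooth algebra, then the `x (e i)` are algebraically
independent. -/
lemma algebraicIndependent_of_linear_part [Fintype σ] [DecidableEq σ] [Fintype τ] [DecidableEq τ]
    {D : Type*} [CommRing D] [Algebra K D]
    [Algebra.FormallySmooth K D] (x : σ → D) (hx : Function.Surjective (aeval x : _ →ₐ[K] D))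
    (h0 : ∀ P : MvPolynomial σ K, aeval x P = 0 → coeff 0 P = 0)
    (e : τ → σ) (he : Function.Injective e)
    (h1 : ∀ P : MvPolynomial σ K, aeval x P = 0 →
      (∀ j, j ∉ Set.range e → coeff (Finsupp.single j 1) P = 0) →
      ∀ j, coeff (Finsupp.single j 1) P = 0) :
    AlgebraicIndependent K (x ∘ e) := by
  let lin : MvPolynomial σ K →ₗ[K] (σ → K) := LinearMap.pi fun j => lcoeff K (Finsupp.single j 1)
  let J : Ideal (MvPolynomial σ K) := RingHom.ker (aeval x : _ →ₐ[K] D)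
  -- V consists of the linear parts of relations. By `h1` it meets the span of the basis vectors e i
  -- trivially, so some linear π kills V and sends these vectors to the standard basis. Substituting
  -- the linear forms given by π annihilates relations modulo m^2.
  let V : Submodule K (σ → K) := (J.restrictScalars K).map lin
  let b : τ → σ → K := fun i => Pi.single (e i) 1
  let ρ : (τ → K) →ₗ[K] (σ → K) ⧸ V := V.mkQ ∘ₗ Fintype.linearCombination K b
  have hlc (v : τ → K) (j : σ) (hj : j ∉ Set.range e) :
      Fintype.linearCombination K b v j = 0 := by
    rw [Fintype.linearCombination_apply, Finset.sum_apply]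
    refine Finset.sum_eq_zero fun i _ => ?_
    rw [Pi.smul_apply, show b _ = Pi.single _ 1 from rfl, Pi.single_eq_of_ne (fun h => hj ⟨i, h.symm⟩), smul_zero]
  have hlc' (v : τ → K) (i : τ) :
      Fintype.linearCombination K b v (e i) = v i := by
    rw [Fintype.linearCombination_apply, Finset.sum_apply, Finset.sum_eq_single i]
    · simp [b]
    · intro k _ hk
      rw [Pi.smul_apply, show b _ = Pi.single _ 1 from rfl, Pi.single_eq_of_ne (fun h => hk (he h.symm)), smul_zero]
    · simp
  have hρ : LinearMap.ker ρ = ⊥ := by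
    rw [LinearMap.ker_eq_bot']
    intro v hv
    rw [LinearMap.comp_apply, Submodule.mkQ_apply, Submodule.Quotient.mk_eq_zero] at hv
    obtain ⟨P, hP, hPv⟩ := hv
    have hPv' (j : σ) := congr_fun hPv j
    ext i
    rw [← hlc' v i, ← hPv' (e i)]
    refine h1 P hP (fun j hj => ?_) (e i)
    rw [← hlc v j hj]
    exact hPv' j
  obtain ⟨π, hπ⟩ := ρ.exists_leftInverse_of_injective hρ
  let Φ : MvPolynomial σ K →ₐ[K] MvPolynomial τ K :=
    aeval fun j => ∑ i, C (π (V.mkQ (Pi.single j 1)) i) * X i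
  have hΦ (j : σ) : Φ (X j) ∈ idealOfVars τ K := by
    rw [aeval_X]
    exact sum_mem fun i _ => Ideal.mul_mem_left _ _ (Ideal.subset_span ⟨i, rfl⟩)
  have hJ (P : MvPolynomial σ K) (hP : P ∈ J) :
      (Ideal.Quotient.mkₐ K (idealOfVars τ K ^ 2)).comp Φ P = 0 := by
    rw [AlgHom.comp_apply, Ideal.Quotient.mkₐ_eq_mk, Ideal.Quotient.eq_zero_iff_mem]
    have hlinear : Φ (∑ j, C (lin P j) * X j) = 0 := by
      have hv : V.mkQ (∑ j, lin P j • Pi.single j (1 : K)) = 0 := by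
        rw [← pi_eq_sum_univ', Submodule.mkQ_apply, Submodule.Quotient.mk_eq_zero]
        exact ⟨P, hP, rfl⟩
      have hv2 (i : τ) : ∑ j, lin P j * π (V.mkQ (Pi.single j 1)) i = 0 := by
        have := congr_fun (congr_arg π hv) i
        simpa [map_sum, Finset.sum_apply] using this
      simp only [map_sum, map_mul, Φ, aeval_X, algHom_C, Finset.mul_sum, ← mul_assoc,
        algebraMap_eq]
      simp only [← C_mul]
      rw [Finset.sum_comm]
      simp only [← Finset.sum_mul, ← map_sum, hv2]
      simp
    have hquad : P - ∑ j, C (lin P j) * X j ∈ idealOfVars σ K ^ 2 := by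
      rw [mem_pow_idealOfVars_iff']
      intro s hs
      have hcoeff : coeff s (∑ j, C (lin P j) * X j) =
          ∑ j, if Finsupp.single j 1 = s then lin P j else 0 := by
        rw [coeff_sum]
        exact Finset.sum_congr rfl fun j _ => by rw [coeff_C_mul, coeff_X]; simp
      rw [coeff_sub, hcoeff]
      rcases Nat.eq_zero_or_pos s.degree with hs0 | hs0
      · rw [(Finsupp.degree_eq_zero_iff s).mp hs0, h0 P hP]
        simp
      · obtain ⟨j, rfl⟩ : ∃ j, s = Finsupp.single j 1 := by
          obtain ⟨j, hj⟩ := Finsupp.ne_iff.mp fun h => hs0.ne' ((Finsupp.degree_eq_zero_iff s).mpr h)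
          obtain ⟨r, rfl⟩ := le_iff_exists_add.mp (Finsupp.single_le_iff.mpr
            (Nat.one_le_iff_ne_zero.mpr hj))
          rw [map_add, Finsupp.degree_single] at hs
          rw [(Finsupp.degree_eq_zero_iff r).mp (by omega), add_zero]
          exact ⟨j, rfl⟩
        rw [Finset.sum_eq_single j]
        · simp [lin]
        · intro k _ hk
          rw [if_neg fun h => hk (Finsupp.single_left_injective one_ne_zero h)]
        · simp
    have := map_mem_pow_idealOfVars Φ hΦ hquad
    rwa [map_sub, hlinear, sub_zero] at this
  let g : D →ₐ[K] MvPolynomial τ K ⧸ idealOfVars τ K ^ 2 :=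
    (Ideal.Quotient.liftₐ J _ hJ).comp
      (Ideal.quotientKerAlgEquivOfSurjective hx).symm.toAlgHom
  have hg (P : MvPolynomial σ K) : g (aeval x P) = Ideal.Quotient.mk _ (Φ P) := by
    have : (Ideal.quotientKerAlgEquivOfSurjective hx).symm (aeval x P) =
        Ideal.Quotient.mk _ P := by
      rw [AlgEquiv.symm_apply_eq]; rfl
    change Ideal.Quotient.liftₐ J _ hJ ((Ideal.quotientKerAlgEquivOfSurjective hx).symm _) = _
    rw [this]
    rfl
  refine algebraicIndependent_of_formallySmooth (x ∘ e) g fun i => ?_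
  have h2 := hg (X (e i))
  rw [aeval_X] at h2
  rw [Function.comp_apply, h2]
  congr 1
  have h3 : π (V.mkQ (Pi.single (e i) 1)) = Pi.single i 1 := by
    have := LinearMap.congr_fun hπ (Pi.single i 1)
    simpa [ρ, b, Fintype.linearCombination_apply_single] using this
  simp only [Φ, aeval_X, h3]
  rw [Finset.sum_eq_single i]
  · simp
  · intro k _ hk
    simp [Pi.single_eq_of_ne hk]
  · simp

end FormallySmooth

section

open Polynomial

/-! ### Differentials of the coefficients of a product of linear factors -/

section RootPoly

variable {K : Type u} [Field K]

/-- The polynomial with constant coefficient `1` whose inverse roots are the negatives of the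
variables, with multiplicities `w`. -/
def rootPoly (K : Type u) [Field K] {ι : Type} [Fintype ι] (w : ι → ℕ) : (MvPolynomial ι K)[X] :=
  ∏ i, (1 + C (MvPolynomial.X i) * X) ^ w i

lemma natDegree_one_add_C_mul_X_le {R : Type*} [CommRing R] (b : R) :
    (1 + C b * X).natDegree ≤ 1 := by
  refine (natDegree_add_le _ _).trans (max_le (by simp) (natDegree_C_mul_le _ _ |>.trans
    natDegree_X_le))

/-- The extension of a derivation to polynomials, acting on the coefficients. -/
def coeffDerivation {B : Type*} [CommRing B] [Algebra K B] (D : Derivation K B B) :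
    Derivation K B[X] B[X] :=
  (PolynomialModule.equivPolynomialSelf (R := B)).toLinearMap.compDer D.mapCoeffs

lemma coeff_coeffDerivation {B : Type*} [CommRing B] [Algebra K B] (D : Derivation K B B)
    (f : B[X]) (k : ℕ) : (coeffDerivation D f).coeff k = D (f.coeff k) := rfl

lemma coeffDerivation_linear_factor {ι : Type} [DecidableEq ι] (i j : ι) :
    coeffDerivation (MvPolynomial.pderiv (R := K) i) (1 + C (MvPolynomial.X j) * X) =
      if j = i then X else 0 := by
  ext1 k
  rw [coeff_coeffDerivation]
  rcases k with _ | _ | k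
  · split_ifs <;> simp
  · split_ifs with h
    · subst h; simp [coeff_one]
    · simp [coeff_one, MvPolynomial.pderiv_X_of_ne h]
  · split_ifs <;> simp [coeff_one, coeff_X]

/-- This is the logarithmic derivative ∂_i f / f = w_i T / (1 + x_i T), cleared of its denominator.
-/
lemma mul_coeffDerivation_prod {ι : Type} [DecidableEq ι] (w : ι → ℕ) (i : ι) (S : Finset ι) :
    (1 + C (MvPolynomial.X i) * X) * coeffDerivation (MvPolynomial.pderiv (R := K) i)
        (∏ j ∈ S, (1 + C (MvPolynomial.X j) * X) ^ w j) =
      if i ∈ S then (w i : (MvPolynomial ι K)[X]) * X *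
        ∏ j ∈ S, (1 + C (MvPolynomial.X j) * X) ^ w j else 0 := by
  induction S using Finset.induction_on with
  | empty => simp
  | insert s S hs ih =>
    rw [Finset.prod_insert hs, Derivation.leibniz, Derivation.leibniz_pow,
      coeffDerivation_linear_factor, mul_add, smul_eq_mul, mul_left_comm, ih]
    by_cases hsi : s = i
    · subst hsi
      rw [if_neg hs, if_pos rfl, if_pos (Finset.mem_insert_self _ _)]
      rcases hw : w s with _ | n
      · simp
      · simp only [nsmul_eq_mul, smul_eq_mul, Nat.add_sub_cancel]
        ring
    · rw [if_neg hsi]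
      by_cases hi : i ∈ S
      · rw [if_pos hi, if_pos (Finset.mem_insert_of_mem hi)]
        simp only [smul_zero, mul_zero, add_zero]
        ring
      · rw [if_neg hi, if_neg (by simp [hi, Ne.symm hsi])]
        simp

variable {ι : Type} [Fintype ι]

lemma natDegree_rootPoly_le (w : ι → ℕ) : (rootPoly K w).natDegree ≤ ∑ i, w i :=
  (natDegree_prod_le _ _).trans (Finset.sum_le_sum fun i _ => by
    simpa using natDegree_pow_le_of_le (w i) 
      (natDegree_one_add_C_mul_X_le (MvPolynomial.X i : MvPolynomial ι K)))

lemma coeff_rootPoly_zero (w : ι → ℕ) : (rootPoly K w).coeff 0 = 1 := by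
  simp [coeff_zero_eq_eval_zero, rootPoly, eval_prod]

lemma isHomogeneous_coeff_rootPoly (w : ι → ℕ) (k : ℕ) :
    ((rootPoly K w).coeff k).IsHomogeneous k := by
  let H : Submonoid (MvPolynomial ι K)[X] :=
    { carrier := {f | ∀ k, (f.coeff k).IsHomogeneous k}
      one_mem' := fun k => by
        rw [coeff_one]
        split_ifs with hk
        · subst hk; exact MvPolynomial.isHomogeneous_one _ _
        · exact MvPolynomial.isHomogeneous_zero _ _ _
      mul_mem' := fun {f g} hf hg k => by
        rw [coeff_mul]
        refine MvPolynomial.IsHomogeneous.sum _ _ _ fun p hp => ?_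
        rw [← Finset.HasAntidiagonal.mem_antidiagonal.mp hp]
        exact (hf _).mul (hg _) }
  have hfactor (i : ι) : 1 + C (MvPolynomial.X i : MvPolynomial ι K) * X ∈ H := by
    intro k
    rcases k with _ | _ | k
    · simpa using MvPolynomial.isHomogeneous_one ι K
    · simpa [coeff_one] using MvPolynomial.isHomogeneous_X K i
    · simpa [coeff_one, coeff_X] using MvPolynomial.isHomogeneous_zero ι K (k + 2)
  exact H.prod_mem (fun i _ => H.pow_mem (hfactor i) (w i)) k

lemma pderiv_coeff_rootPoly_succ (w : ι → ℕ) (i : ι) (l : ℕ) :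
    MvPolynomial.pderiv i ((rootPoly K w).coeff (l + 1)) = (w i : MvPolynomial ι K) *
      (rootPoly K w).coeff l - MvPolynomial.X i * MvPolynomial.pderiv i ((rootPoly K w).coeff l) := by
  classical
  have h := congr_arg (coeff · (l + 1)) (mul_coeffDerivation_prod (K := K) w i Finset.univ)
  simp only [Finset.mem_univ, if_true, add_mul, one_mul, coeff_add, mul_assoc, coeff_C_mul,
    coeff_X_mul, coeff_coeffDerivation] at h
  rw [← map_natCast (C : MvPolynomial ι K →+* _), coeff_C_mul, coeff_X_mul] at h
  exact eq_sub_of_add_eq h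

/-- The partial derivatives of the coefficients of `rootPoly` are up to a factor the values at the
variables of these polynomials. -/
def derivPoly (w : ι → ℕ) : ℕ → (MvPolynomial ι K)[X]
  | 0 => 1
  | l + 1 => C ((rootPoly K w).coeff (l + 1)) - X * derivPoly w l

lemma pderiv_coeff_rootPoly (w : ι → ℕ) (i : ι) (l : ℕ) :
    MvPolynomial.pderiv i ((rootPoly K w).coeff (l + 1)) =
      (w i : MvPolynomial ι K) * (derivPoly w l).eval (MvPolynomial.X i) := by
  induction l with
  | zero => rw [pderiv_coeff_rootPoly_succ, coeff_rootPoly_zero]; simp [derivPoly]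
  | succ l ih =>
    rw [pderiv_coeff_rootPoly_succ, ih, derivPoly]
    simp only [eval_sub, eval_C, eval_mul, eval_X]
    ring

lemma natDegree_derivPoly_le (w : ι → ℕ) (l : ℕ) :
    (derivPoly (K := K) w l).natDegree ≤ l := by
  induction l with
  | zero => simp [derivPoly]
  | succ l ih =>
    rw [derivPoly]
    refine (natDegree_sub_le _ _).trans (max_le (by simp) (natDegree_mul_le.trans ?_))
    have := natDegree_X_le (R := MvPolynomial ι K)
    omega

lemma coeff_derivPoly_self (w : ι → ℕ) (l : ℕ) :
    (derivPoly (K := K) w l).coeff l = (-1) ^ l := by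
  induction l with
  | zero => simp [derivPoly]
  | succ l ih => rw [derivPoly, coeff_sub, coeff_C_succ, coeff_X_mul, ih]; ring

lemma coeff_derivPoly_succ (w : ι → ℕ) (l : ℕ) :
    (derivPoly (K := K) w (l + 1)).coeff l = (-1) ^ l * (rootPoly K w).coeff 1 := by
  induction l with
  | zero => simp [derivPoly]
  | succ l ih => rw [derivPoly, coeff_sub, coeff_C_succ, coeff_X_mul, ih]; ring

/-- A relation between the differentials of the first `n + 1` coefficients of `rootPoly` forces
all multiplicities to be equal, provided that its last two coefficients have the form they have for
a weighted homogeneous relation. -/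
lemma weights_eq_of_differential_relation [CharZero K] {w : ι → ℕ} (hw : ∀ i, w i ≠ 0) {k : ℕ}
    (hk : k ≤ Fintype.card ι) (Q : ℕ → MvPolynomial ι K) {α : K} (hα : α ≠ 0)
    (hQ : ∀ i, ∑ j ∈ Finset.range (k + 1), Q j *
      MvPolynomial.pderiv i ((rootPoly K w).coeff (j + 1)) = 0)
    (hQk : Q k = MvPolynomial.C α)
    (hQk' : ∀ l, k = l + 1 → ∃ β : K, Q l = MvPolynomial.C β * (rootPoly K w).coeff 1) (i j : ι) :
    w i = w j := by
  -- The i-th relation `hQ` says w_i V(x_i) = 0: one polynomial V has all variables as roots.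
  let V : (MvPolynomial ι K)[X] := ∑ j ∈ Finset.range (k + 1), C (Q j) * derivPoly w j
  have hinj : Function.Injective (MvPolynomial.X : ι → MvPolynomial ι K) :=
    MvPolynomial.X_injective
  have hV (i : ι) : V.eval (MvPolynomial.X i) = 0 := by
    have h : (w i : MvPolynomial ι K) * V.eval (MvPolynomial.X i) = 0 := by
      rw [← hQ i, eval_finsetSum, Finset.mul_sum]
      refine Finset.sum_congr rfl fun j _ => ?_
      rw [pderiv_coeff_rootPoly, eval_mul, eval_C]
      ring
    exact (mul_eq_zero.mp h).resolve_left (Nat.cast_ne_zero.mpr (hw i))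
  have hVdeg : V.natDegree ≤ k := natDegree_sum_le_of_forall_le _ _ fun j hj =>
    (natDegree_C_mul_le _ _).trans ((natDegree_derivPoly_le w j).trans
      (by have := Finset.mem_range.mp hj; omega))
  have hVk : V.coeff k = MvPolynomial.C α * (-1) ^ k := by
    rw [finsetSum_coeff, Finset.sum_range_succ, Finset.sum_eq_zero, zero_add, coeff_C_mul, hQk,
      coeff_derivPoly_self]
    intro j hj
    rw [coeff_C_mul, coeff_eq_zero_of_natDegree_lt, mul_zero]
    exact (natDegree_derivPoly_le w j).trans_lt (Finset.mem_range.mp hj)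
  -- V has degree k with nonzero leading coefficient, so k cannot be less than its number of
  -- distinct roots.
  have hk' : k = Fintype.card ι := by
    by_contra hne
    have h0 := eq_zero_of_natDegree_lt_card_of_eval_eq_zero V hinj hV (by omega)
    rw [h0, coeff_zero] at hVk
    exact mul_ne_zero (MvPolynomial.C_ne_zero.mpr hα) (pow_ne_zero _ (by simp)) hVk.symm
  have hcard : 0 < Fintype.card ι := Fintype.card_pos_iff.mpr ⟨i⟩
  obtain ⟨l, rfl⟩ : ∃ l, k = l + 1 := ⟨k - 1, by omega⟩
  obtain ⟨β, hβ⟩ := hQk' l rfl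
  let R : (MvPolynomial ι K)[X] := ∏ i, (X - C (MvPolynomial.X i))
  have hRdeg : R.natDegree = l + 1 := by
    rw [natDegree_prod_of_monic _ _ fun i _ => monic_X_sub_C _]
    simp [hk']
  have hRmonic : R.Monic := monic_prod_of_monic _ _ fun i _ => monic_X_sub_C _
  have hRl : R.coeff l = -∑ i, MvPolynomial.X i := by
    have := prod_X_sub_C_coeff_card_pred Finset.univ (fun i => (MvPolynomial.X i : MvPolynomial ι K))
      (by rw [Finset.card_univ]; exact hcard)
    rwa [Finset.card_univ, ← hk', Nat.add_sub_cancel] at this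
  have hVR : V - C (MvPolynomial.C α * (-1) ^ (l + 1)) * R = 0 := by
    refine eq_zero_of_natDegree_lt_card_of_eval_eq_zero _ hinj (fun i => ?_) ?_
    · rw [eval_sub, hV, eval_mul, eval_prod, Finset.prod_eq_zero (Finset.mem_univ i) (by simp)]
      simp
    · rw [← hk', Nat.lt_succ_iff, natDegree_le_iff_coeff_eq_zero]
      intro N hN
      rw [coeff_sub, coeff_C_mul]
      rcases (Nat.succ_le_of_lt hN).eq_or_lt with rfl | hN
      · have hR1 : R.coeff (l + 1) = 1 := by rw [← hRdeg, hRmonic.coeff_natDegree]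
        rw [Nat.succ_eq_add_one, hVk, hR1, mul_one, sub_self]
      · rw [coeff_eq_zero_of_natDegree_lt (by omega), coeff_eq_zero_of_natDegree_lt (by omega)]
        simp
  -- Only the last two summands reach degree l: the top one contributes α and the one before it β.
  have hVl : V.coeff l = (-1) ^ l * (MvPolynomial.C (α + β) * (rootPoly K w).coeff 1) := by
    rw [finsetSum_coeff, Finset.sum_range_succ, Finset.sum_range_succ, Finset.sum_eq_zero,
      zero_add, coeff_C_mul, coeff_C_mul, hQk, hβ, coeff_derivPoly_self, coeff_derivPoly_succ,
      MvPolynomial.C_add]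
    · ring
    intro j hj
    rw [coeff_C_mul, coeff_eq_zero_of_natDegree_lt, mul_zero]
    exact (natDegree_derivPoly_le w j).trans_lt (Finset.mem_range.mp hj)
  have hsum : MvPolynomial.C (α + β) * (rootPoly K w).coeff 1 =
      MvPolynomial.C α * ∑ i, MvPolynomial.X i := by
    have h := congr_arg (coeff · l) (sub_eq_zero.mp hVR)
    simp only [coeff_C_mul, hVl, hRl] at h
    refine mul_left_cancel₀ (pow_ne_zero l (neg_ne_zero.mpr one_ne_zero)) (h.trans ?_)
    ring
  have hlin (i : ι) : (α + β) * (w i : K) = α := by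
    have h := congr_arg (MvPolynomial.pderiv i) hsum
    rw [MvPolynomial.pderiv_C_mul, MvPolynomial.pderiv_C_mul, pderiv_coeff_rootPoly, map_sum,
      Finset.sum_eq_single i (fun j _ hj => MvPolynomial.pderiv_X_of_ne hj) (by simp)] at h
    simp only [derivPoly, eval_one, mul_one, MvPolynomial.pderiv_X_self] at h
    rw [← map_natCast (MvPolynomial.C : K →+* MvPolynomial ι K), ← MvPolynomial.C_mul] at h
    exact MvPolynomial.C_injective _ _ h
  have hαβ : α + β ≠ 0 := fun h => hα (by rw [← hlin i, h, zero_mul])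
  exact_mod_cast mul_left_cancel₀ hαβ ((hlin i).trans (hlin j).symm)

end RootPoly

end

/-! ### Weighted homogeneous relations and their derivatives -/

section WeightedRelation

open MvPolynomial

variable {K : Type u} [Field K] {σ ι : Type*}

lemma pderiv_aeval [Fintype σ] (y : σ → MvPolynomial ι K) (P : MvPolynomial σ K) (i : ι) :
    pderiv i (aeval y P) = ∑ j, aeval y (pderiv j P) * pderiv i (y j) := by
  classical
  induction P using MvPolynomial.induction_on with
  | C c => simp [algHom_C]
  | add p q hp hq => simp only [map_add, hp, hq, add_mul, Finset.sum_add_distrib]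
  | mul_X p k hp =>
    simp only [map_mul, aeval_X, Derivation.leibniz, hp, smul_eq_mul, map_add, add_mul,
      Finset.sum_add_distrib, pderiv_X]
    congr 1
    · rw [Finset.sum_eq_single k]
      · simp
      · intro j _ hj
        rw [Pi.single_eq_of_ne hj.symm]; simp
      · simp
    · rw [Finset.mul_sum]
      exact Finset.sum_congr rfl fun j _ => by ring

/-- Substitution turns weight into degree; hence the weighted components of a relation are again
relations. -/
lemma homogeneousComponent_aeval {y : σ → MvPolynomial ι K} {v : σ → ℕ}
    (hy : ∀ j, (y j).IsHomogeneous (v j)) (k : ℕ) (P : MvPolynomial σ K) :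
    homogeneousComponent k (aeval y P) = aeval y (weightedHomogeneousComponent v k P) := by
  induction P using MvPolynomial.induction_on' with
  | monomial m c =>
    have h1 : (aeval y (monomial m c)).IsHomogeneous (Finsupp.weight v m) := by
      rw [aeval_monomial, algebraMap_eq, Finsupp.weight_apply]
      have := (isHomogeneous_C ι c).mul (IsHomogeneous.prod m.support (fun j => y j ^ m j)
        (fun j => v j * m j) fun j _ => (hy j).pow (m j))
      rw [zero_add] at this
      simpa only [Finsupp.sum, Finsupp.prod, smul_eq_mul, mul_comm] using this
    rw [homogeneousComponent_of_mem h1, weightedHomogeneousComponent_of_mem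
      (isWeightedHomogeneous_monomial v m c rfl)]
    split_ifs <;> simp
  | add p q hp hq => simp only [map_add, hp, hq]

lemma pderiv_eq_zero_of_lt_weight {P : MvPolynomial σ K} {v : σ → ℕ} {k : ℕ}
    (hP : P.IsWeightedHomogeneous v k) {j : σ} (hj : k < v j) : pderiv j P = 0 := by
  refine pderiv_eq_zero_of_notMem_vars fun hmem => ?_
  obtain ⟨m, hm, hjm⟩ := (mem_vars_iff_mem_support j).mp hmem
  have h1 := hP (mem_support_iff.mp hm)
  have h2 := Finsupp.le_weight_of_ne_zero' (w := v) (f := m) (s := j) (Finsupp.mem_support_iff.mp hjm)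
  omega

lemma pderiv_eq_C_of_weight_eq {P : MvPolynomial σ K} {v : σ → ℕ} (hv : ∀ j, v j ≠ 0) {k : ℕ}
    (hP : P.IsWeightedHomogeneous v k) {j : σ} (hj : v j = k) :
    pderiv j P = C (coeff (Finsupp.single j 1) P) := by
  have h := hP.pderiv (i := j) (n' := 0) (by rw [zero_add, hj])
  have h2 := weightedHomogeneousComponent_zero (pderiv j P) hv
  rw [h.weightedHomogeneousComponent_same] at h2
  rw [h2, coeff_pderiv]
  simp

lemma eq_C_mul_X_of_isWeightedHomogeneous_one {P : MvPolynomial σ K} {v : σ → ℕ}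
    (hv : ∀ j, v j ≠ 0) (hP : P.IsWeightedHomogeneous v 1) {i : σ} (hi : ∀ j, v j = 1 → j = i) :
    P = C (coeff (Finsupp.single i 1) P) * X i := by
  classical
  ext m
  rw [coeff_C_mul, coeff_X]
  split_ifs with h
  · rw [h, mul_one]
  · rw [mul_zero]
    by_contra hm
    have hw := hP hm
    obtain ⟨j, hj⟩ := Finsupp.ne_iff.mp (show m ≠ 0 by rintro rfl; simp at hw)
    obtain ⟨r, rfl⟩ := le_iff_exists_add.mp (Finsupp.single_le_iff.mpr
      (Nat.one_le_iff_ne_zero.mpr hj))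
    rw [map_add, Finsupp.weight_single, one_smul] at hw
    have := hv j
    have hr : r = 0 := by
      by_contra hr
      obtain ⟨l, hl⟩ := Finsupp.ne_iff.mp hr
      have h2 := Finsupp.le_weight_of_ne_zero' (w := v) (f := r) (s := l) hl
      have := hv l
      omega
    subst hr
    rw [hi j (by simp at hw; omega), add_zero] at h
    exact h rfl

end WeightedRelation

/-! ### Smoothness forces equal parts -/

section NotEven

variable {K : Type u} [Field K] {ι : Type} [Fintype ι]

lemma weights_eq_of_formallySmooth [CharZero K] {d : ℕ} {w : ι → ℕ} (hw : ∀ i, w i ≠ 0)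
    (hd : Fintype.card ι + 1 ≤ d)
    (h : Algebra.FormallySmooth K (Algebra.adjoin K (Set.range fun j : Fin (d + 1) =>
      (rootPoly K w).coeff j))) (i j : ι) : w i = w j := by
  classical
  set D := Algebra.adjoin K (Set.range fun j : Fin (d + 1) => (rootPoly K w).coeff j) with hD
  let a : Fin d → MvPolynomial ι K := fun j => (rootPoly K w).coeff (j + 1)
  let v : Fin d → ℕ := fun j => j + 1
  have hv (j) : v j ≠ 0 := Nat.succ_ne_zero _
  have ha (j : Fin d) : (a j).IsHomogeneous (v j) := isHomogeneous_coeff_rootPoly w _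
  let x : Fin d → D := fun j => ⟨a j, Algebra.subset_adjoin ⟨j.succ, rfl⟩⟩
  have hxa (P : MvPolynomial (Fin d) K) :
      (MvPolynomial.aeval x P : D).1 = MvPolynomial.aeval a P := by
    have : D.val.comp (MvPolynomial.aeval x) = MvPolynomial.aeval a := by ext1 j; simp [x]
    exact DFunLike.congr_fun this P
  have hx : Function.Surjective (MvPolynomial.aeval x : _ →ₐ[K] D) := by
    rintro ⟨b, hb⟩
    have hle : D ≤ (MvPolynomial.aeval a : _ →ₐ[K] MvPolynomial ι K).range := by
      refine Algebra.adjoin_le ?_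
      rintro _ ⟨j, rfl⟩
      refine Fin.cases ?_ (fun j => ?_) j
      · exact ⟨1, by simp [coeff_rootPoly_zero]⟩
      · exact ⟨MvPolynomial.X j, by simp [a]⟩
    obtain ⟨P, hP⟩ := hle hb
    exact ⟨P, Subtype.ext ((hxa P).trans hP)⟩
  have hcomp {P : MvPolynomial (Fin d) K} (hP : MvPolynomial.aeval x P = 0) (k : ℕ) :
      MvPolynomial.aeval a (MvPolynomial.weightedHomogeneousComponent v k P) = 0 := by
    rw [← homogeneousComponent_aeval ha, ← hxa, hP]
    simp
  by_contra hne
  refine absurd (algebraicIndependent_of_linear_part x hx (fun P hP => ?_) (Fin.castLE hd)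
    (Fin.castLE_injective hd) fun P hP hPe => ?_) fun hind => ?_
  · have h1 := hcomp hP 0
    rw [MvPolynomial.weightedHomogeneousComponent_zero _ hv, MvPolynomial.algHom_C] at h1
    exact (FaithfulSMul.algebraMap_eq_zero_iff _ _).mp h1
  · by_contra! hcon
    obtain ⟨k, hk⟩ := hcon
    have hkn : (k : ℕ) < Fintype.card ι + 1 := by
      by_contra hkn
      refine hk (hPe k ?_)
      rintro ⟨l, rfl⟩
      exact hkn l.2
    -- The variable with index k has weight k + 1, so this component keeps the nonzero linear
    -- coefficient.
    let P' := MvPolynomial.weightedHomogeneousComponent v (k + 1) P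
    have hP' : P'.IsWeightedHomogeneous v (k + 1) :=
      MvPolynomial.weightedHomogeneousComponent_isWeightedHomogeneous _ _
    have hcoeff : MvPolynomial.coeff (Finsupp.single k 1) P' =
        MvPolynomial.coeff (Finsupp.single k 1) P := by
      rw [MvPolynomial.coeff_weightedHomogeneousComponent, if_pos]
      simp [v, Finsupp.weight_single]
    -- By weight, the partial derivatives of P' vanish for j > k, are constant for j = k, and are a
    -- multiple of the weight-one variable for j = k - 1.
    let Q : ℕ → MvPolynomial ι K := fun j =>
      if hj : j < d then MvPolynomial.aeval a (MvPolynomial.pderiv ⟨j, hj⟩ P') else 0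
    refine hne (weights_eq_of_differential_relation hw (k := k) (by omega) Q hk (fun i => ?_) ?_
      (fun l hl => ?_) i j)
    · have h1 := congr_arg (MvPolynomial.pderiv i) (hcomp hP (k + 1))
      rw [pderiv_aeval, map_zero] at h1
      rw [← h1, Finset.sum_subset (Finset.range_subset_range.mpr k.2), Finset.sum_range]
      · refine Finset.sum_congr rfl fun j _ => ?_
        simp only [Q, dif_pos j.2]
        rfl
      · intro l hl hlk
        rw [Finset.mem_range] at hl hlk
        simp only [Q, dif_pos hl]
        rw [pderiv_eq_zero_of_lt_weight hP' (by simp only [v]; omega), map_zero, zero_mul]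
    · simp only [Q, dif_pos k.2]
      rw [pderiv_eq_C_of_weight_eq hv hP' rfl, hcoeff, MvPolynomial.algHom_C]
      rfl
    · have hld : l < d := by omega
      have hd0 : 0 < d := by omega
      have h2 := eq_C_mul_X_of_isWeightedHomogeneous_one hv
        (hP'.pderiv (i := ⟨l, hld⟩) (n' := 1) (by simp only [v]; omega)) (i := ⟨0, hd0⟩)
        (fun j hj => Fin.ext (Nat.succ_injective hj))
      refine ⟨MvPolynomial.coeff (Finsupp.single ⟨0, hd0⟩ 1) (MvPolynomial.pderiv ⟨l, hld⟩ P'), ?_⟩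
      simp only [Q, dif_pos hld]
      exact (congr_arg _ h2).trans (by
        rw [map_mul, MvPolynomial.algHom_C, MvPolynomial.aeval_X]; rfl)
  -- More algebraically independent elements than the polynomial ring has variables.
  · have h1 := hind.map' (f := D.val) Subtype.val_injective
    have h2 := h1.lift_cardinalMk_le_trdeg
    rw [MvPolynomial.trdeg_of_isDomain] at h2
    simp only [Cardinal.mk_fintype, Fintype.card_fin, Cardinal.lift_natCast, Nat.cast_le] at h2
    omega

/-- Since g(0) = 1 every root r is nonzero and contributes c = -1/r; a degree below e is made up by
zeros among the c i. -/
lemma exists_prod_one_add_C_mul_X [IsAlgClosed K] (e : ℕ) (g : Polynomial K) (h0 : g.eval 0 = 1)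
    (he : g.natDegree ≤ e) :
    ∃ c : Fin e → K, g = ∏ i, (1 + Polynomial.C (c i) * Polynomial.X) := by
  induction e generalizing g with
  | zero =>
    obtain ⟨s, rfl⟩ := Polynomial.natDegree_eq_zero.mp (Nat.le_zero.mp he)
    rw [Polynomial.eval_C] at h0
    exact ⟨0, by simp [h0]⟩
  | succ e ih =>
    by_cases hg : g.natDegree = 0
    · obtain ⟨s, rfl⟩ := Polynomial.natDegree_eq_zero.mp hg
      rw [Polynomial.eval_C] at h0
      exact ⟨0, by simp [h0]⟩
    · obtain ⟨r, hr⟩ := IsAlgClosed.exists_root g fun h => hg (Polynomial.natDegree_eq_of_degree_eq_some h)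
      obtain ⟨q, rfl⟩ := Polynomial.dvd_iff_isRoot.mpr hr
      have hr0 : r ≠ 0 := by
        rintro rfl
        simp at h0
      have hq : q ≠ 0 := by
        rintro rfl
        simp at h0
      obtain ⟨c, hc⟩ := ih (Polynomial.C (-r) * q) (by simpa using h0) (by
        rw [Polynomial.natDegree_mul (Polynomial.X_sub_C_ne_zero r) hq,
          Polynomial.natDegree_X_sub_C] at he
        exact (Polynomial.natDegree_C_mul_le _ _).trans (by omega))
      refine ⟨Fin.cons (-r⁻¹) c, ?_⟩
      rw [Fin.prod_univ_succ]
      simp only [Fin.cons_zero, Fin.cons_succ]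
      rw [← hc, ← mul_assoc]
      congr 1
      rw [add_mul, one_mul, mul_right_comm, ← Polynomial.C_mul, neg_mul_neg, inv_mul_cancel₀ hr0,
        Polynomial.C_neg, Polynomial.C_1]
      ring

/-- The linear factors of a form in the coincident root locus, without the multiplicities. -/
abbrev Factors {d : ℕ} (lam : d.Partition) : Type :=
  Σ r : Finset.Icc 1 d, Fin (lam.parts.count (r : ℕ))

lemma prod_factors {d : ℕ} (lam : d.Partition) {M : Type*} [CommMonoid M]
    (F : Factors lam → M) (G : ℕ → M)
    (h : ∀ r : Finset.Icc 1 d, ∏ i, F ⟨r, i⟩ = G r) :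
    ∏ s, F s = ∏ r ∈ Finset.Icc 1 d, G r := by
  rw [Fintype.prod_sigma, ← Finset.prod_coe_sort (Finset.Icc 1 d)]
  exact Finset.prod_congr rfl fun r _ => h r

lemma sum_factors {d : ℕ} (lam : d.Partition) : ∑ s : Factors lam, (s.1 : ℕ) = d := by
  rw [Fintype.sum_sigma]
  simp only [Finset.sum_const, Finset.card_univ, Fintype.card_fin, smul_eq_mul]
  rw [Finset.sum_coe_sort (Finset.Icc 1 d) fun r => lam.parts.count r * r, sum_count_mul]

lemma isEven_of_smooth [IsAlgClosed K] [CharZero K] {d : ℕ} {lam : d.Partition}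
    (h : Smooth (coincidentRootLocusToSpec K lam)) : IsEven lam := by
  let w : Factors lam → ℕ := fun s => s.1
  have hw (s) : w s ≠ 0 := by
    have := (Finset.mem_Icc.mp s.1.2).1
    simp only [w]; omega
  have hmap (c : Factors lam → K) : (rootPoly K w).map (MvPolynomial.eval c) =
      ∏ s : Factors lam, (1 + Polynomial.C (c s) * Polynomial.X) ^ w s := by
    simp [rootPoly, Polynomial.map_prod]
  have hsm := (smooth_chart_valueAt_iff (lam := lam) (t := 0) (f := rootPoly K w)
    ((natDegree_rootPoly_le w).trans (sum_factors lam).le) ?_ (fun c => ?_) fun g hg => ?_).mp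
    (MorphismProperty.comp_mem @Smooth _ _ inferInstance h)
  · have hsm' := hsm.formallySmooth
    intro r hr s hs
    by_contra hrs
    have hcard : Fintype.card (Factors lam) + 1 ≤ d := by
      by_contra hcard
      -- At least d positive weights with sum d must all be 1.
      have hone : ∀ s : Factors lam, 1 = w s := by
        have h1 : ∑ s : Factors lam, 1 = ∑ s : Factors lam, w s := by
          refine le_antisymm (Finset.sum_le_sum fun s _ => Nat.one_le_iff_ne_zero.mpr (hw s)) ?_
          rw [sum_factors]
          rw [Finset.sum_const, Finset.card_univ, smul_eq_mul, mul_one]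
          omega
        intro s
        exact (Finset.sum_eq_sum_iff_of_le
          fun s _ => Nat.one_le_iff_ne_zero.mpr (hw s)).mp h1 s (Finset.mem_univ s)
      exact hrs ((hone ⟨⟨r, mem_Icc_of_mem_parts hr⟩, ⟨0, Multiset.count_pos.mpr hr⟩⟩).symm.trans
        (hone ⟨⟨s, mem_Icc_of_mem_parts hs⟩, ⟨0, Multiset.count_pos.mpr hs⟩⟩))
    exact hrs (weights_eq_of_formallySmooth hw hcard hsm'
      ⟨⟨r, mem_Icc_of_mem_parts hr⟩, ⟨0, Multiset.count_pos.mpr hr⟩⟩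
      ⟨⟨s, mem_Icc_of_mem_parts hs⟩, ⟨0, Multiset.count_pos.mpr hs⟩⟩)
  · rw [MvPolynomial.C_0, ← Polynomial.coeff_zero_eq_eval_zero, coeff_rootPoly_zero]
  · let G : ℕ → Polynomial K := fun r =>
      if hr : r ∈ Finset.Icc 1 d then
        ∏ i : Fin (lam.parts.count r), (1 + Polynomial.C (c ⟨⟨r, hr⟩, i⟩) * Polynomial.X) else 0
    refine ⟨G, fun r hr => ?_, ?_⟩
    · simp only [G, dif_pos hr]
      refine ⟨Finset.prod_ne_zero_iff.mpr fun i _ h0 => ?_, ?_⟩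
      · have := congr_arg (Polynomial.eval 0) h0
        simp at this
      · refine (Polynomial.natDegree_prod_le _ _).trans ((Finset.sum_le_sum fun i _ =>
          natDegree_one_add_C_mul_X_le _).trans ?_)
        simp
    · rw [hmap]
      refine prod_factors lam _ (fun r => G r ^ r) fun r => ?_
      simp only [G, dif_pos r.2, w]
      rw [Finset.prod_pow]
  · have hex (r : Finset.Icc 1 d) := exists_prod_one_add_C_mul_X _ (g r) (hg r r.2).1 (hg r r.2).2
    choose c hc using hex
    refine ⟨fun s => c s.1 s.2, ?_⟩
    rw [hmap]
    refine (prod_factors lam _ (fun r => g r ^ r) fun r => ?_).symm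
    simp only [w]
    rw [Finset.prod_pow, ← hc r]

end NotEven

end CoincidentRoot

end

theorem mainTheorem5 {K : Type*} [Field K] [IsAlgClosed K] [CharZero K]
    {d : ℕ} (hd : 0 < d) (lam : d.Partition) :
    AlgebraicGeometry.Smooth (CoincidentRoot.coincidentRootLocusToSpec K lam) ↔
      CoincidentRoot.IsEven lam :=
  ⟨CoincidentRoot.isEven_of_smooth, CoincidentRoot.smooth_of_isEven hd⟩
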